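/- Let $\mathbb{k}$ be a field and let $H$ be a Hopf algebra over $\mathbb{k}$ with bijective antipode and counit $\varepsilon$. Put $H^e = H\otimes_{\mathbb{k}} H^{op}$ and assume that $H$ is homologically smooth, i.e. $H$ has a bounded resolution by finitely generated projective $H^e$-modules. Write ${}_\varepsilon\mathbb{k}$ and $\mathbb{k}_\varepsilon$ for the left and the right trivial $H$-module defined by $\varepsilon$. Recall that $H$ is a twisted Calabi-Yau algebra of dimension $d$ if it is homologically smooth and there is an algebra automorphism $\mu$ of $H$ such that, as $H$-bimodules, $\operatorname{Ext}^i_{H^e}(H,H^e)=0$ for $i\neq d$ and $\operatorname{Ext}^d_{H^e}(H,H^e)\cong H^\mu$, where $H^\mu$ is $H$ with the bimodule structure $a\cdot m\cdot b = a\,m\,\mu(b)$. For every integer $d\ge 0$ the following are equivalent: (i) $H$ is a twisted Calabi-Yau algebra of dimension $d$. (ii) $\operatorname{Ext}^i_H({}_\varepsilon\mathbb{k},H)=0$ for $i\neq d$ and $\dim\operatorname{Ext}^d_H({}_\varepsilon\mathbb{k},H)=1$. (iii) $\operatorname{Ext}^i_{H^{op}}(\mathbb{k}_\varepsilon,H)=0$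 for $i\neq d$ and $\dim\operatorname{Ext}^d_{H^{op}}(\mathbb{k}_\varepsilon,H)=1$. (iv) $\operatorname{Ext}^i_H({}_\varepsilon\mathbb{k},H)$ and $\operatorname{Ext}^i_{H^{op}}(\mathbb{k}_\varepsilon,H)$ are finite dimensional for all $i\ge 0$, $\dim\operatorname{Ext}^i_H({}_\varepsilon\mathbb{k},H)=\dim\operatorname{Ext}^i_{H^{op}}(\mathbb{k}_\varepsilon,H)=0$ for $i>d$, and $\dim\operatorname{Ext}^d_H({}_\varepsilon\mathbb{k},H)\neq 0$ or $\dim\operatorname{Ext}^d_{H^{op}}(\mathbb{k}_\varepsilon,H)\neq 0$. In these cases the left and the right global dimension of $H$ and the injective dimensions of ${}_HH$ and $H_H$ are all equal to $d$. -/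

import Mathlib

open CategoryTheory CategoryTheory.Abelian TensorProduct MulOpposite

universe u

noncomputable section

/-- `M` has a bounded resolution `0 → Pₙ → ⋯ → P₀ → M → 0` by finitely generated projective
`R`-modules. -/
def HasBoundedFGProjectiveResolution {R : Type u} [Ring R] (M : ModuleCat.{u} R) : Prop :=
  ∃ P : ProjectiveResolution M,
    (∀ i, Module.Finite R (P.complex.X i)) ∧ ∃ n : ℕ, ∀ i, n < i → Limits.IsZero (P.complex.X i)

/-- The left global dimension of a ring: the supremum of the projective dimensions of all left
modules. For right modules, apply it to `Rᵐᵒᵖ`. -/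
def globalDimension (R : Type u) [Ring R] : WithBot ℕ∞ :=
  ⨆ M : ModuleCat.{u} R, projectiveDimension M

section Enveloping

variable (k : Type u) [Field k] (A : Type u) [Ring A] [Algebra k A]

/-- The enveloping algebra `Aᵉ = A ⊗ Aᵒᵖ`. -/
abbrev EnvelopingAlgebra : Type u := A ⊗[k] Aᵐᵒᵖ

/-- `A` as a left `Aᵉ`-module, `(a ⊗ b) • x = a x b`. -/
def envelopingDiagonal : ModuleCat.{u} (EnvelopingAlgebra k A) :=
  letI := instModuleTensorProductMop k A
  ModuleCat.of (EnvelopingAlgebra k A) A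

/-- `Aᵉ` as a left module over itself. -/
def envelopingRegular : ModuleCat.{u} (EnvelopingAlgebra k A) :=
  ModuleCat.of (EnvelopingAlgebra k A) (EnvelopingAlgebra k A)

/-- Right multiplication by `r` on `Aᵉ`, an endomorphism of the left `Aᵉ`-module `Aᵉ`. -/
def envelopingMulRight (r : EnvelopingAlgebra k A) :
    envelopingRegular k A ⟶ envelopingRegular k A :=
  ModuleCat.ofHom (LinearMap.toSpanSingleton (EnvelopingAlgebra k A) (EnvelopingAlgebra k A) r)

/-- `Extⁱ_{Aᵉ}(A, Aᵉ)`, computed with the left `Aᵉ`-module structure of `Aᵉ`. -/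
abbrev EnvelopingExt (i : ℕ) : Type u :=
  Ext.{u} (envelopingDiagonal k A) (envelopingRegular k A) i

/-- The right `Aᵉ`-module structure of `Extⁱ_{Aᵉ}(A, Aᵉ)`, induced by functoriality from the right
multiplication of `Aᵉ` on itself. Writing `b e a` for the action of `a ⊗ b` on `e` makes
`Extⁱ_{Aᵉ}(A, Aᵉ)` an `A`-bimodule. -/
def EnvelopingExt.rightAction {i : ℕ} (e : EnvelopingExt k A i) (r : EnvelopingAlgebra k A) :
    EnvelopingExt k A i :=
  e.comp (Ext.mk₀ (envelopingMulRight k A r)) (add_zero i)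

/-- `A` has a bounded resolution by finitely generated projective `Aᵉ`-modules. -/
def IsHomologicallySmooth : Prop :=
  HasBoundedFGProjectiveResolution (envelopingDiagonal k A)

/-- `A` is a twisted Calabi-Yau algebra of dimension `d`: it is homologically smooth,
`Extⁱ_{Aᵉ}(A, Aᵉ) = 0` for `i ≠ d`, and `Extᵈ_{Aᵉ}(A, Aᵉ) ≅ A^μ` as `A`-bimodules for some algebra
automorphism `μ` of `A`, where `A^μ` is `A` with the bimodule structure `b · x · a = b x μ(a)`. -/
structure IsTwistedCalabiYau (d : ℕ) : Prop where
  smooth : IsHomologicallySmooth k A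
  ext_eq_zero : ∀ i, i ≠ d → Subsingleton (EnvelopingExt k A i)
  ext_iso : ∃ (μ : A ≃ₐ[k] A) (φ : EnvelopingExt k A d ≃+ A), ∀ (a b : A) (e : EnvelopingExt k A d),
    φ (e.rightAction k A (a ⊗ₜ[k] op b)) = b * φ e * μ a

end Enveloping

section Hopf

variable (k : Type u) [Field k] (H : Type u) [Ring H] [Bialgebra k H]

/-- The left trivial module: `k` with `h • x = ε(h) x`. -/
def leftTrivial : ModuleCat.{u} H :=
  (ModuleCat.restrictScalars (Bialgebra.counitAlgHom k H : H →+* k)).obj (ModuleCat.of k k)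

/-- The right trivial module: `k` with `x • h = x ε(h)`, as a left module over `Hᵒᵖ`. -/
def rightTrivial : ModuleCat.{u} Hᵐᵒᵖ :=
  (ModuleCat.restrictScalars ((Bialgebra.counitAlgHom k H : H →+* k).fromOpposite
    fun _ _ => Commute.all _ _)).obj (ModuleCat.of k k)

/-- `Extⁱ_H(k, H)` for left `H`-modules; a `k`-vector space. -/
abbrev LeftExt (i : ℕ) : Type u := Ext.{u} (leftTrivial k H) (ModuleCat.of H H) i

/-- `Extⁱ_{Hᵒᵖ}(k, H)` for right `H`-modules; a `k`-vector space. -/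
abbrev RightExt (i : ℕ) : Type u := Ext.{u} (rightTrivial k H) (ModuleCat.of Hᵐᵒᵖ H) i

end Hopf

end

/-! Restriction along the algebra map `adjointHom`, h ↦ h₁ ⊗ S(h₂), turns an Hᵉ-module N into an
H-module ad N. Its left adjoint is M ↦ M ⊗ H (`bimoduleAdj`), which sends the trivial module k to
the bimodule H. Both functors are exact, so Extⁱ_{Hᵉ}(H, N) ≅ Extⁱ_H(k, ad N) (`adjointExtEquiv`).

For N = Hᵉ the module ad N is diagonal, and `untwist` identifies it with the free module H ⊗ Hᵒᵖ.
Smoothness makes Ext out of k compatible with direct sums (`HasLocallyFiniteExt`), so Extⁱ_{Hᵉ}(H,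
Hᵉ) looks like Extⁱ_H(k, H) ⊗ H, and both vanish in the same degrees. If Extᵈ_H(k, H) is a line, H
acts on it from the right by a character ξ, and the bimodule is H^μ with μ(a) = ξ(a₁) S²(a₂).
Conversely, contracting H^μ with ε leaves a line. This gives (i) ⇔ (ii). For (ii) ⇔ (iii), the
isomorphism S : H → Hᵒᵖ matches the trivial modules and the regular modules of the two sides.

For (iv) ⇒ (ii), vanishing above d bounds the global dimension by d: Ext(M, N) ≅ Ext(k, Hom(M, N))
reduces this to k, whose projective dimension is finite and hence detected on H. Let P be the given
resolution of H and let K = Hom(P, H), where H carries the trivial right action. Then K is a complex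
of projective H-modules with cohomology Extⁱ_H(k, H). Let V be its lowest nonzero cohomology, in
degree s ≤ d. Since V is finite dimensional and Extᵈ_H(k, H) ≠ 0, Extᵈ(V, H) contains a copy of V^*
(`exists_injective_dual_ext`). On the other hand V lies in the cokernel T of K_{s-1} → K_s, which
has projective dimension at most s, and Extᵈ(T, -) → Extᵈ(V, -) is onto. Hence s = d, and Extᵈ(V, H)
is a quotient of Hom(K₀, H). Every map K₀ → H is evaluation at an element of P₀. Boundaries from P₁
give zero and the right action becomes ε, so Extᵈ(V, H) is a quotient of H ⊗_H k = k
(`exists_span_ext`). Therefore dim V ≤ 1.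

The dimensions equal d because they are at most d and Extᵈ_H(k, H) ≠ 0; the right-handed ones follow
through S. -/

noncomputable section

/-! ### Ext and adjunctions between exact functors -/

section ExtAdjunction

universe w w' v v' u₁ u₂

open Limits

variable {C : Type u₁} [Category.{v} C] [Abelian C] [HasExt.{w} C]
  {D : Type u₂} [Category.{v'} D] [Abelian D] [HasExt.{w'} D]
  {F : C ⥤ D} {G : D ⥤ C} (adj : F ⊣ G)
  [G.Additive] [PreservesFiniteLimits G] [PreservesFiniteColimits G]

lemma CategoryTheory.ShortComplex.ShortExact.extClass_comp_mk₀_comp {S S' : ShortComplex C}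
    (hS : S.ShortExact) (hS' : S'.ShortExact) (τ : S ⟶ S') {Y : C} {n : ℕ}
    (y : Ext.{w} S'.X₁ Y n) :
    hS.extClass.comp ((Ext.mk₀ τ.τ₁).comp y (zero_add n)) (add_comm 1 n) =
      (Ext.mk₀ τ.τ₃).comp (hS'.extClass.comp y (add_comm 1 n)) (zero_add (n + 1)) := by
  rw [← Ext.comp_assoc_of_second_deg_zero, ShortComplex.ShortExact.extClass_naturality hS hS' τ]
  exact Ext.comp_assoc _ _ _ (zero_add 1) (add_comm 1 n) (by lia)

namespace CategoryTheory.Adjunction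

/-- The map `Ext (F X) Y n → Ext X (G Y) n` attached to an adjunction `F ⊣ G` with `G` exact. -/
def extAddHom (X : C) (Y : D) (n : ℕ) : Ext.{w'} (F.obj X) Y n →+ Ext.{w} X (G.obj Y) n :=
  ((Ext.mk₀ (adj.unit.app X)).precomp (G.obj Y) (zero_add n)).comp
    (G.mapExtAddHom (F.obj X) Y n)

lemma extAddHom_apply {X : C} {Y : D} {n : ℕ} (e : Ext.{w'} (F.obj X) Y n) :
    adj.extAddHom X Y n e =
      (Ext.mk₀ (adj.unit.app X)).comp (e.mapExactFunctor G) (zero_add n) := rfl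

lemma extAddHom_comp_mk₀ {X : C} {Y Y' : D} {n : ℕ} (e : Ext.{w'} (F.obj X) Y n) (g : Y ⟶ Y') :
    adj.extAddHom X Y' n (e.comp (Ext.mk₀ g) (add_zero n)) =
      (adj.extAddHom X Y n e).comp (Ext.mk₀ (G.map g)) (add_zero n) := by
  rw [extAddHom_apply, extAddHom_apply, Ext.mapExactFunctor_comp, Ext.mapExactFunctor_mk₀,
    Ext.comp_assoc_of_third_deg_zero]

lemma extAddHom_mk₀ {X : C} {Y : D} (f : F.obj X ⟶ Y) :
    adj.extAddHom X Y 0 (Ext.mk₀ f) = Ext.mk₀ (adj.homEquiv X Y f) := by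
  rw [extAddHom_apply, Ext.mapExactFunctor_mk₀, Ext.mk₀_comp_mk₀, adj.homEquiv_unit]

variable [F.Additive] [PreservesFiniteLimits F] [PreservesFiniteColimits F]

set_option linter.unusedSectionVars false

/-- The units of the adjunction form a morphism from `S` to its image under `F` and then `G`, so
this is naturality of the extension class. -/
lemma extClass_comp_extAddHom {S : ShortComplex C} (hS : S.ShortExact) {Y : D} {n : ℕ}
    (x : Ext.{w'} (S.map F).X₁ Y n) :
    hS.extClass.comp (adj.extAddHom S.X₁ Y n x) (add_comm 1 n) =
      adj.extAddHom S.X₃ Y (n + 1) ((hS.map_of_exact F).extClass.comp x (add_comm 1 n)) := by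
  let τ : S ⟶ (S.map F).map G :=
    { τ₁ := adj.unit.app _
      τ₂ := adj.unit.app _
      τ₃ := adj.unit.app _
      comm₁₂ := (adj.unit.naturality S.f).symm
      comm₂₃ := (adj.unit.naturality S.g).symm }
  change hS.extClass.comp ((Ext.mk₀ τ.τ₁).comp
    (Ext.mapExactFunctor G (X := (S.map F).X₁) x) (zero_add n)) (add_comm 1 n) =
      (Ext.mk₀ τ.τ₃).comp (Ext.mapExactFunctor G (X := (S.map F).X₃)
        ((hS.map_of_exact F).extClass.comp x (add_comm 1 n))) (zero_add (n + 1))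
  rw [Ext.mapExactFunctor_comp, Ext.mapExactFunctor_extClass]
  exact ShortComplex.ShortExact.extClass_comp_mk₀_comp hS ((hS.map_of_exact F).map_of_exact G) τ _

attribute [local instance] Ext.subsingleton_of_projective in
-- Dimension shifting. Since `G` preserves epimorphisms, `F` preserves projectives, so a projective
-- presentation of `X` stays one under `F`. On both sides Ext in degree n + 1 is then a cokernel of
-- a map in degree n, and degree 0 is the adjunction itself.
lemma extAddHom_bijective [EnoughProjectives C] (X : C) (Y : D) (n : ℕ) :
    Function.Bijective (adj.extAddHom X Y n) := by
  have : F.PreservesProjectiveObjects :=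
    F.preservesProjectiveObjects_of_adjunction_of_preservesEpimorphisms adj
  induction n generalizing X with
  | zero =>
    have : ⇑(adj.extAddHom X Y 0) =
        Ext.homEquiv₀.symm ∘ adj.homEquiv X Y ∘ Ext.homEquiv₀ := by
      ext x
      obtain ⟨y, rfl⟩ := (Ext.mk₀_bijective _ _).2 x
      rw [extAddHom_mk₀]
      simp [Ext.homEquiv₀]
    rw [this]
    exact (Equiv.bijective _).comp ((Equiv.bijective _).comp (Equiv.bijective _))
  | succ n hn =>
    let P : ProjectivePresentation X := Classical.arbitrary _
    let S := ShortComplex.mk _ _ (kernel.condition P.f)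
    have : Projective (S.map F).X₂ := Functor.PreservesProjectiveObjects.projective_obj P.projective
    have hS : S.ShortExact := { exact := ShortComplex.exact_kernel P.f }
    refine AddMonoidHom.bijective_of_surjective_of_bijective_of_right_exact
      _ _ _ _
      (adj.extAddHom S.X₂ Y n) (adj.extAddHom S.X₁ Y n) (adj.extAddHom S.X₃ Y (n + 1))
      ?_ ?_
      ((ShortComplex.ab_exact_iff_function_exact _).1
        (Ext.contravariant_sequence_exact₁' (hS.map_of_exact F) Y n (n + 1) (add_comm 1 n)))
      ((ShortComplex.ab_exact_iff_function_exact _).1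
        (Ext.contravariant_sequence_exact₁' hS (G.obj Y) n (n + 1) (add_comm 1 n)))
      (hn _).surjective (hn _)
      (fun x₃ ↦ Ext.contravariant_sequence_exact₃ (hS.map_of_exact F) _ x₃ (by subsingleton)
        (add_comm 1 n))
      (fun y₃ ↦ Ext.contravariant_sequence_exact₃ hS _ y₃ (by subsingleton) (add_comm 1 n))
    · ext x
      change (Ext.mk₀ S.f).comp (adj.extAddHom S.X₂ Y n x) (zero_add n) =
        adj.extAddHom S.X₁ Y n ((Ext.mk₀ (F.map S.f)).comp x (zero_add n))
      simp only [extAddHom_apply, Ext.mapExactFunctor_comp, Ext.mapExactFunctor_mk₀,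
        Ext.mk₀_comp_mk₀_assoc]
      congr 2
      exact adj.unit.naturality S.f
    · ext x
      exact adj.extClass_comp_extAddHom hS x

/-- An adjunction `F ⊣ G` of exact functors induces isomorphisms `Ext (F X) Y n ≃ Ext X (G Y) n`. -/
def extAddEquiv [EnoughProjectives C] (X : C) (Y : D) (n : ℕ) :
    Ext.{w'} (F.obj X) Y n ≃+ Ext.{w} X (G.obj Y) n :=
  AddEquiv.ofBijective (adj.extAddHom X Y n) (adj.extAddHom_bijective X Y n)

lemma extAddEquiv_comp_mk₀ [EnoughProjectives C]
    {X : C} {Y Y' : D} {n : ℕ} (e : Ext.{w'} (F.obj X) Y n) (g : Y ⟶ Y') :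
    adj.extAddEquiv X Y' n (e.comp (Ext.mk₀ g) (add_zero n)) =
      (adj.extAddEquiv X Y n e).comp (Ext.mk₀ (G.map g)) (add_zero n) :=
  adj.extAddHom_comp_mk₀ e g

lemma extAddEquiv_smul [EnoughProjectives C] {k : Type*} [Ring k] [Linear k C] [Linear k D]
    [G.Linear k] (X : C) (Y : D) (n : ℕ) (r : k) (e : Ext.{w'} (F.obj X) Y n) :
    adj.extAddEquiv X Y n (r • e) = r • adj.extAddEquiv X Y n e := by
  rw [Ext.smul_eq_comp_mk₀, Ext.smul_eq_comp_mk₀, extAddEquiv_comp_mk₀, G.map_smul, G.map_id]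

/-- Over a base ring for which `G` is linear, `extAddEquiv` is linear. -/
def extLinearEquiv [EnoughProjectives C] (k : Type*) [Ring k] [Linear k C] [Linear k D]
    [G.Linear k] (X : C) (Y : D) (n : ℕ) :
    Ext.{w'} (F.obj X) Y n ≃ₗ[k] Ext.{w} X (G.obj Y) n :=
  { adj.extAddEquiv X Y n with map_smul' := adj.extAddEquiv_smul X Y n }

end CategoryTheory.Adjunction

end ExtAdjunction

/-! ### Transport of Ext along isomorphisms, and Ext by cocycles -/

section ExtMisc

universe w v u₁

variable {C : Type u₁} [Category.{v} C] [Abelian C] [HasExt.{w} C]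

/-- Precomposition with an isomorphism as an isomorphism of `Ext` groups. -/
def CategoryTheory.Abelian.Ext.precompIso {X X' : C} (i : X ≅ X') (Y : C) (n : ℕ) :
    Ext.{w} X' Y n ≃+ Ext.{w} X Y n where
  toFun e := (Ext.mk₀ i.hom).comp e (zero_add n)
  invFun e := (Ext.mk₀ i.inv).comp e (zero_add n)
  left_inv e := by simp
  right_inv e := by simp
  map_add' := by simp

/-- Postcomposition with an isomorphism as an isomorphism of `Ext` groups. -/
def CategoryTheory.Abelian.Ext.postcompIso (X : C) {Y Y' : C} (i : Y ≅ Y') (n : ℕ) :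
    Ext.{w} X Y n ≃+ Ext.{w} X Y' n where
  toFun e := e.comp (Ext.mk₀ i.hom) (add_zero n)
  invFun e := e.comp (Ext.mk₀ i.inv) (add_zero n)
  left_inv e := by simp
  right_inv e := by simp
  map_add' := by simp

lemma CategoryTheory.Abelian.Ext.precompIso_smul {k : Type*} [Ring k] [Linear k C] {X X' : C}
    (i : X ≅ X') (Y : C) (n : ℕ) (r : k) (e : Ext.{w} X' Y n) :
    Ext.precompIso i Y n (r • e) = r • Ext.precompIso i Y n e :=
  Ext.comp_smul _ _ (zero_add n) _

lemma CategoryTheory.Abelian.Ext.postcompIso_smul {k : Type*} [Ring k] [Linear k C] (X : C)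
    {Y Y' : C} (i : Y ≅ Y') (n : ℕ) (r : k) (e : Ext.{w} X Y n) :
    Ext.postcompIso X i n (r • e) = r • Ext.postcompIso X i n e :=
  Ext.smul_comp _ _ (add_zero n) _

namespace CategoryTheory.ProjectiveResolution

variable {X Y : C} (R : ProjectiveResolution X)

open CochainComplex HomComplex in
-- There are no coboundaries in degree 0, because the resolution, read as a cochain complex,
-- vanishes in degree 1.
lemma extMk_zero_eq_zero_iff (f : R.complex.X 0 ⟶ Y) (m : ℕ) (hm : 0 + 1 = m)
    (hf : R.complex.d m 0 ≫ f = 0) :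
    R.extMk f m hm hf = 0 ↔ f = 0 := by
  simp only [← R.extEquivCohomologyClass.apply_eq_iff_eq,
    extEquivCohomologyClass_extMk, extEquivCohomologyClass_zero,
    CohomologyClass.mk_eq_zero_iff]
  rw [Cocycle.toSingleMk_mem_coboundaries_iff _ _ _ _ _ 1 (by lia)]
  have : Limits.IsZero (R.cochainComplex.X 1) :=
    CochainComplex.isZero_of_isStrictlyLE _ 0 1 (by lia)
  constructor
  · rintro ⟨g, hg⟩
    rw [this.eq_of_src g 0, Limits.comp_zero] at hg
    rw [← cancel_epi (R.cochainComplexXIso (-(0 : ℕ)) 0 rfl).hom, Limits.comp_zero]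
    exact hg.symm
  · rintro rfl
    exact ⟨0, by simp⟩

lemma extMk_smul {k : Type*} [Ring k] [Linear k C] {n : ℕ} (r : k) (f : R.complex.X n ⟶ Y) (m : ℕ)
    (hm : n + 1 = m) (hf : R.complex.d m n ≫ f = 0) :
    R.extMk (r • f) m hm (by simp [hf]) = r • R.extMk f m hm hf := by
  rw [Ext.smul_eq_comp_mk₀, extMk_comp_mk₀]
  congr 1
  simp

end CategoryTheory.ProjectiveResolution

end ExtMisc

/-! ### Finiteness of Ext, and the first cohomology of a complex of projectives -/

section ModuleExt

variable {R : Type u} [Ring R]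

/-- If `X` has a resolution by finitely generated projectives and the endomorphisms `q j` of `N`
sum up, locally finitely, to the identity, then every class in `Ext X N n` is a finite sum of
its images under the `q j`. -/
lemma ModuleCat.ext_eq_sum_comp_of_finite {X : ModuleCat.{u} R} (P : ProjectiveResolution X)
    (hP : ∀ i, Module.Finite R (P.complex.X i)) {N : ModuleCat.{u} R} {J : Type*} (q : J → (N ⟶ N))
    (hq : ∀ x : N, ∃ s : Finset J, ∀ t, s ⊆ t → ∑ j ∈ t, (q j).hom x = x) {n : ℕ}
    (e : Ext.{u} X N n) :
    ∃ t : Finset J, e = ∑ j ∈ t, e.comp (Ext.mk₀ (q j)) (add_zero n) := by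
  classical
  obtain ⟨f, hf, rfl⟩ := P.extMk_surjective e (n + 1) rfl
  choose s hs using hq
  obtain ⟨S, hS⟩ := (hP n).fg_top
  -- A cocycle is determined on the finite generating set `S`, and each of its values there needs
  -- only finitely many indices.
  refine ⟨S.biUnion fun x => s (f.hom x), ?_⟩
  set t := S.biUnion fun x => s (f.hom x)
  have hsum : f = ∑ j ∈ t, f ≫ q j := by
    ext1
    rw [ModuleCat.hom_sum]
    refine LinearMap.ext_on_range (v := ((↑) : S → P.complex.X n)) (by simpa using hS) fun x => ?_
    rw [LinearMap.sum_apply]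
    exact (hs _ t (Finset.subset_biUnion_of_mem (fun x => s (f.hom x)) x.2)).symm
  have hg : P.complex.d (n + 1) n ≫ (∑ j ∈ t, f ≫ q j) = 0 := by rw [← hsum, hf]
  have key : ∀ t : Finset J, ∀ hg : P.complex.d (n + 1) n ≫ (∑ j ∈ t, f ≫ q j) = 0,
      P.extMk (∑ j ∈ t, f ≫ q j) (n + 1) rfl hg =
        ∑ j ∈ t, (P.extMk f (n + 1) rfl hf).comp (Ext.mk₀ (q j)) (add_zero n) := by
    intro t
    induction t using Finset.induction_on with
    | empty => intro hg; simp
    | insert a t ha ih =>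
      intro hg
      have h1 : P.complex.d (n + 1) n ≫ f ≫ q a = 0 := by
        rw [← Category.assoc, hf, Limits.zero_comp]
      have h2 : P.complex.d (n + 1) n ≫ (∑ j ∈ t, f ≫ q j) = 0 := by
        rw [Preadditive.comp_sum]
        exact Finset.sum_eq_zero fun j _ => by rw [← Category.assoc, hf, Limits.zero_comp]
      have h3 := Finset.sum_insert (f := fun j => f ≫ q j) ha
      simp only [h3]
      refine Eq.trans ?_ (Finset.sum_insert ha).symm
      rw [← ih h2, P.extMk_comp_mk₀, P.add_extMk]
  rw [← key t hg]
  congr 1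

variable {K : ℕ → ModuleCat.{u} R} (δ : ∀ i, K i ⟶ K (i + 1))

/-- The predicate of being a coboundary in the sequence `0 → K 0 → K 1 → ⋯`. -/
def IsCoboundary : ∀ i, K i → Prop
  | 0, x => x = 0
  | i + 1, x => ∃ y : K i, (δ i).hom y = x

variable {δ} in
lemma IsCoboundary.map_eq_zero (hδ : ∀ i, δ i ≫ δ (i + 1) = 0) {s : ℕ} {x : K s}
    (hx : IsCoboundary δ s x) : (δ s).hom x = 0 := by
  cases s with
  | zero => rw [show x = 0 from hx, map_zero]
  | succ s =>
    obtain ⟨y, rfl⟩ := hx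
    exact congr($(hδ s).hom y)

lemma ModuleCat.exists_desc_of_surjective {M N T : ModuleCat.{u} R} (p : M ⟶ T) (f : M ⟶ N)
    (hp : Function.Surjective p.hom) (h : ∀ x, p.hom x = 0 → f.hom x = 0) :
    ∃ j : T ⟶ N, p ≫ j = f := by
  have : Epi p := (ModuleCat.epi_iff_surjective _).2 hp
  let S : ShortComplex (ModuleCat.{u} R) := ShortComplex.mk (ModuleCat.ofHom
    (LinearMap.ker p.hom).subtype) p (by ext x; exact x.2)
  have hS : S.Exact := ModuleCat.shortComplex_exact S fun x =>
    ⟨fun hx => ⟨⟨x, hx⟩, rfl⟩, by rintro ⟨y, rfl⟩; exact y.2⟩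
  have : Epi S.g := this
  have w : S.f ≫ f = 0 := by ext x; exact h _ x.2
  exact ⟨hS.desc f w, hS.g_desc f w⟩

/-- If `0 → K 0 → K 1 → ⋯` is a complex of projectives, exact in degrees below `s`, then the
cokernel `T` of `K (s - 1) → K s` has projective dimension at most `s`, and a universal class in
`Ext T (K 0) s`. -/
lemma exists_cokernel_of_exact [∀ i, Projective (K i)] (s : ℕ)
    (hδ : ∀ i, δ i ≫ δ (i + 1) = 0)
    (hex : ∀ i < s, ∀ x : K i, (δ i).hom x = 0 → IsCoboundary δ i x) :
    ∃ (T : ModuleCat.{u} R) (p : K s ⟶ T), Function.Surjective p.hom ∧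
      (∀ x, p.hom x = 0 ↔ IsCoboundary δ s x) ∧ HasProjectiveDimensionLT T (s + 1) ∧
      ∃ γ : Ext.{u} T (K 0) s,
        (∀ (Y : ModuleCat.{u} R) (e : Ext.{u} T Y s),
          ∃ f : K 0 ⟶ Y, e = γ.comp (Ext.mk₀ f) (add_zero s)) ∧
        ∀ j : T ⟶ K (s + 1), p ≫ j = δ s →
          ∀ (m m' : ℕ) (hm : m + s = m') (Z : ModuleCat.{u} R) (e : Ext.{u} Z T m),
            e.comp (Ext.mk₀ j) (add_zero m) = 0 →
              e.comp (γ.comp (Ext.mk₀ (δ 0)) (add_zero s)) hm = 0 := by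
  induction s with
  | zero =>
    -- In degree 0 nothing is divided out, and the universal class is the identity.
    refine ⟨K 0, 𝟙 _, fun x => ⟨x, rfl⟩, fun x => Iff.rfl, inferInstance, Ext.mk₀ (𝟙 _), ?_, ?_⟩
    · intro Y e
      obtain ⟨f, rfl⟩ := (Ext.mk₀_bijective _ _).2 e
      exact ⟨f, by simp⟩
    · intro j hj m m' hm Z e he
      obtain rfl : m = m' := hm
      rw [Category.id_comp] at hj
      subst hj
      simpa using he
  | succ s ih =>
    obtain ⟨T, p, hp, hpk, hpd, γ, hγ, hγ0⟩ := ih fun i hi => hex i (by omega)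
    obtain ⟨i, hi'⟩ := ModuleCat.exists_desc_of_surjective p (δ s) hp
      fun x hx => ((hpk x).1 hx).map_eq_zero hδ
    have hi : ∀ x, i.hom (p.hom x) = (δ s).hom x := fun x => congr($(hi').hom x)
    let T' : ModuleCat.{u} R := ModuleCat.of R (K (s + 1) ⧸ LinearMap.range (δ s).hom)
    let p' : K (s + 1) ⟶ T' := ModuleCat.ofHom (Submodule.mkQ _)
    have hw : i ≫ p' = 0 := by
      ext x
      obtain ⟨x, rfl⟩ := hp x
      change Submodule.Quotient.mk (i.hom (p.hom x)) = 0
      rw [hi]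
      exact (Submodule.Quotient.mk_eq_zero _).2 ⟨x, rfl⟩
    -- Exactness at `K s` makes `i` injective, so one more projective resolves the next cokernel: 0
    -- → T → K (s + 1) → T' → 0.
    let S := ShortComplex.mk i p' hw
    have hS : S.ShortExact := by
      refine ModuleCat.shortComplex_shortExact S ?_ ?_ (Submodule.mkQ_surjective _)
      · intro x
        constructor
        · intro hx
          obtain ⟨y, rfl⟩ := (Submodule.Quotient.mk_eq_zero _).1 hx
          exact ⟨p.hom y, hi y⟩
        · rintro ⟨y, rfl⟩
          exact congr($(hw).hom y)
      · refine (injective_iff_map_eq_zero _).2 fun x hx => ?_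
        obtain ⟨x, rfl⟩ := hp x
        exact (hpk x).2 (hex s (by omega) x ((hi x).symm.trans hx))
    have hS1 : HasProjectiveDimensionLT S.X₁ (s + 1) := hpd
    have : Projective S.X₂ := inferInstanceAs (Projective (K (s + 1)))
    refine ⟨T', p', Submodule.mkQ_surjective _, fun x => Submodule.Quotient.mk_eq_zero _,
      hS.hasProjectiveDimensionLT_X₃ (s + 1) hS1 inferInstance,
      hS.extClass.comp γ (add_comm 1 s), ?_, ?_⟩
    · intro Y e
      -- Since `K (s + 1)` is projective, every class on `T'` in positive degree comes from `T` by
      -- the connecting map.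
      obtain ⟨e', he'⟩ := Ext.contravariant_sequence_exact₃ hS Y e
        (Ext.eq_zero_of_projective _) (add_comm 1 s)
      obtain ⟨f, rfl⟩ := hγ Y e'
      exact ⟨f, by rw [← he', Ext.comp_assoc_of_third_deg_zero]⟩
    · intro j hj m m' hm Z e _
      -- The extension class already dies in `K (s + 1)`, so the assumption on `e` matters only for
      -- s = 0.
      have h0 := hγ0 i hi' 1 (s + 1) (add_comm 1 s) _ hS.extClass hS.extClass_comp
      rw [Ext.comp_assoc_of_third_deg_zero, h0, Ext.comp_zero]

/-- In the situation of `exists_cokernel_of_exact`, let `V` be the cohomology in degree `s` and let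
all modules have projective dimension at most `n`. If `s ≤ n` and `Ext V Y n ≠ 0`, then `s = n` and
every class of `Ext V Y n` is the pushforward of a fixed class in `Ext V (K 0) n`, which dies in
`Ext V (K 1) n`. -/
lemma exists_cohomology_ext [∀ i, Projective (K i)] (s n : ℕ)
    (hδ : ∀ i, δ i ≫ δ (i + 1) = 0)
    (hex : ∀ i < s, ∀ x : K i, (δ i).hom x = 0 → IsCoboundary δ i x)
    (hn : ∀ M : ModuleCat.{u} R, HasProjectiveDimensionLT M (n + 1)) (hsn : s ≤ n) :
    ∃ (V : ModuleCat.{u} R) (c : LinearMap.ker (δ s).hom →ₗ[R] V), Function.Surjective c ∧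
      (∀ x, c x = 0 ↔ IsCoboundary δ s x.1) ∧
      ((∃ (Y : ModuleCat.{u} R) (e : Ext.{u} V Y n), e ≠ 0) →
        s = n ∧ ∃ β : Ext.{u} V (K 0) n, β.comp (Ext.mk₀ (δ 0)) (add_zero n) = 0 ∧
          ∀ (Y : ModuleCat.{u} R) (e : Ext.{u} V Y n),
            ∃ f : K 0 ⟶ Y, e = β.comp (Ext.mk₀ f) (add_zero n)) := by
  obtain ⟨T, p, hp, hpk, hpd, γ, hγ, hγ0⟩ := exists_cokernel_of_exact δ s hδ hex
  -- The cohomology, realized as a submodule of the cokernel `T`.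
  let W : Submodule R T := (LinearMap.ker (δ s).hom).map p.hom
  let c : LinearMap.ker (δ s).hom →ₗ[R] W := p.hom.submoduleMap _
  let ι : ModuleCat.of R W ⟶ T := ModuleCat.ofHom W.subtype
  let S : ShortComplex (ModuleCat.{u} R) :=
    ModuleCat.shortComplexOfCompEqZero W.subtype W.mkQ (by ext; simp)
  have hS : S.ShortExact := ModuleCat.shortComplex_shortExact S
    (by intro x; simp [S]) W.injective_subtype W.mkQ_surjective
  -- The obstruction to extending a class from `W` to `T` lies in degree n + 1, where everything
  -- vanishes.
  have hsurj : ∀ (Y : ModuleCat.{u} R) (e : Ext.{u} (ModuleCat.of R W) Y n),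
      ∃ e' : Ext.{u} T Y n, (Ext.mk₀ ι).comp e' (zero_add n) = e := fun Y e =>
    Ext.contravariant_sequence_exact₁ hS Y e (add_comm 1 n)
      (by have := hn S.X₃; exact Ext.eq_zero_of_hasProjectiveDimensionLT _ (n + 1) le_rfl)
  refine ⟨ModuleCat.of R W, c, p.hom.submoduleMap_surjective _, fun x => ?_, ?_⟩
  · rw [← hpk, ← Submodule.coe_eq_zero]
    rfl
  · rintro ⟨Y, e, he⟩
    -- If s < n, the extended class would live on `T`, whose projective dimension is at most s, and
    -- would vanish.
    have hs : s = n := by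
      by_contra hne
      obtain ⟨e', rfl⟩ := hsurj Y e
      apply he
      rw [e'.eq_zero_of_hasProjectiveDimensionLT (s + 1) (by omega), Ext.comp_zero]
    subst hs
    refine ⟨rfl, (Ext.mk₀ ι).comp γ (zero_add s), ?_, ?_⟩
    · rw [Ext.comp_assoc_of_third_deg_zero]
      obtain ⟨j, hj⟩ := ModuleCat.exists_desc_of_surjective p (δ s) hp
        fun x hx => ((hpk x).1 hx).map_eq_zero hδ
      refine hγ0 j hj 0 s (zero_add s) _ (Ext.mk₀ ι) ?_
      rw [Ext.mk₀_comp_mk₀, Ext.mk₀_eq_zero_iff]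
      ext ⟨x, y, hy, rfl⟩
      exact congr($(hj).hom y).trans hy
    · intro Y e
      obtain ⟨e', rfl⟩ := hsurj Y e
      obtain ⟨f, rfl⟩ := hγ Y e'
      exact ⟨f, by rw [Ext.comp_assoc_of_third_deg_zero]⟩

end ModuleExt

/-! ### Untwisting the diagonal action on H ⊗ V -/

section HopfTwist

open Coalgebra HopfAlgebra

lemma Coalgebra.Repr.sum_counit_right_smul {k C ι : Type*} [CommSemiring k] [AddCommMonoid C]
    [Module k C] [Coalgebra k C] {c : C} (r : Repr k c ι) :
    ∑ i ∈ r.index, counit (R := k) (r.right i) • r.left i = c := by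
  simpa only [map_sum, TensorProduct.lift.tmul, LinearMap.flip_apply, LinearMap.lsmul_apply,
    one_smul]
    using congrArg (TensorProduct.lift (LinearMap.lsmul k C).flip) (sum_tmul_counit_eq (R := k) r)

section Twist

variable {k : Type*} [Field k] {C : Type*} [AddCommGroup C] [Module k C] [Coalgebra k C]
  {V : Type*} [AddCommGroup V] [Module k V]

/-- The endomorphism `c ⊗ v ↦ c₍₁₎ ⊗ θ(c₍₂₎) v` of `C ⊗ V`. -/
def comulTwist (θ : C →ₗ[k] Module.End k V) : C ⊗[k] V →ₗ[k] C ⊗[k] V :=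
  (TensorProduct.lift θ).lTensor C ∘ₗ (TensorProduct.assoc k C C V).toLinearMap ∘ₗ
    comul.rTensor V

lemma comulTwist_tmul (θ : C →ₗ[k] Module.End k V) {ι : Type*} {c : C} (r : Repr k c ι) (v : V) :
    comulTwist θ (c ⊗ₜ v) = ∑ i ∈ r.index, r.left i ⊗ₜ θ (r.right i) v := by
  simp [comulTwist, ← r.eq, TensorProduct.sum_tmul]

lemma comulTwist_counit :
    comulTwist (Algebra.linearMap k (Module.End k V) ∘ₗ (counit : C →ₗ[k] k)) = LinearMap.id := by
  refine TensorProduct.ext' fun c v => ?_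
  have r := Repr.arbitrary k c
  rw [comulTwist_tmul _ r]
  simp only [LinearMap.comp_apply, Algebra.linearMap_apply, Module.algebraMap_end_apply,
    LinearMap.id_apply]
  simp_rw [← TensorProduct.smul_tmul, ← TensorProduct.sum_tmul]
  rw [r.sum_counit_right_smul]

/-- Coassociativity. With `comulTwist_counit` it makes `comulTwist` a homomorphism from the
convolution algebra Hom(C, End V). A representation θ has convolution inverse θ ∘ S, so its twist is
invertible. -/
lemma comulTwist_comp (θ θ' : C →ₗ[k] Module.End k V) :
    comulTwist θ ∘ₗ comulTwist θ' =
      comulTwist (LinearMap.mul' k (Module.End k V) ∘ₗ TensorProduct.map θ θ' ∘ₗ comul) := by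
  refine TensorProduct.ext' fun c v => ?_
  let r := Repr.arbitrary k c
  let r₁ := fun i => Repr.arbitrary k (r.left i)
  let r₂ := fun i => Repr.arbitrary k (r.right i)
  rw [LinearMap.comp_apply, comulTwist_tmul _ r, comulTwist_tmul _ r, map_sum]
  simp_rw [fun i => comulTwist_tmul θ (r₁ i)]
  have key := sum_tmul_tmul_eq r r₁ r₂
  let φ : C ⊗[k] (C ⊗[k] C) →ₗ[k] C ⊗[k] V :=
    ((LinearMap.applyₗ v) ∘ₗ LinearMap.mul' k (Module.End k V) ∘ₗ
      TensorProduct.map θ θ').lTensor C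
  have := congr(φ $key)
  simp only [map_sum, φ, LinearMap.lTensor_tmul, LinearMap.comp_apply, TensorProduct.map_tmul,
    LinearMap.mul'_apply, LinearMap.applyₗ_apply_apply, Module.End.mul_apply] at this
  rw [this]
  refine Finset.sum_congr rfl fun i _ => ?_
  rw [← TensorProduct.tmul_sum, LinearMap.comp_apply, LinearMap.comp_apply, ← (r₂ i).eq]
  simp

end Twist

variable {k : Type*} [Field k] {H : Type*} [Ring H] [HopfAlgebra k H]
  {V : Type*} [AddCommGroup V] [Module k V]

/-- The diagonal representation on a tensor product. -/
def tensorRep {M : Type*} [AddCommGroup M] [Module k M] (α : H →ₐ[k] Module.End k M)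
    (θ : H →ₐ[k] Module.End k V) : H →ₐ[k] Module.End k (M ⊗[k] V) :=
  ((Module.endTensorEndAlgHom (R := k) (S := k) (A := k) (M := M) (N := V)).comp
    (Algebra.TensorProduct.map α θ)).comp (Bialgebra.comulAlgHom k H)

lemma tensorRep_apply {M : Type*} [AddCommGroup M] [Module k M] (α : H →ₐ[k] Module.End k M)
    (θ : H →ₐ[k] Module.End k V) {ι : Type*} {h : H} (r : Repr k h ι) (m : M) (v : V) :
    tensorRep α θ h (m ⊗ₜ v) = ∑ i ∈ r.index, α (r.left i) m ⊗ₜ θ (r.right i) v := by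
  simp [tensorRep, ← r.eq, LinearMap.sum_apply, Module.endTensorEndAlgHom_apply]

lemma comulTwist_eq_tensorRep (θ : H →ₐ[k] Module.End k V) (a : H) (v : V) :
    comulTwist θ.toLinearMap (a ⊗ₜ v) = tensorRep (Algebra.lmul k H) θ a (1 ⊗ₜ v) := by
  let r := Repr.arbitrary k a
  rw [comulTwist_tmul _ r, tensorRep_apply _ _ r]
  simp

/-- For a representation `V` of a Hopf algebra `H`, the isomorphism from the free module `H ⊗ V` to
the diagonal one. -/
def untwist (θ : H →ₐ[k] Module.End k V) : H ⊗[k] V ≃ₗ[k] H ⊗[k] V :=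
  LinearEquiv.ofLinearMap (comulTwist θ.toLinearMap) (comulTwist (θ.toLinearMap ∘ₗ antipode k))
    (by
      rw [comulTwist_comp, ← comulTwist_counit (k := k)]
      congr 1
      ext1 a
      let r := Repr.arbitrary k a
      have := sum_mul_antipode_eq_algebraMap_counit r
      simpa [← r.eq] using congr(θ $this))
    (by
      rw [comulTwist_comp, ← comulTwist_counit (k := k)]
      congr 1
      ext1 a
      let r := Repr.arbitrary k a
      have := sum_antipode_mul_eq_algebraMap_counit r
      simpa [← r.eq] using congr(θ $this))

lemma untwist_tmul (θ : H →ₐ[k] Module.End k V) (a : H) (v : V) :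
    untwist θ (a ⊗ₜ v) = tensorRep (Algebra.lmul k H) θ a (1 ⊗ₜ v) :=
  comulTwist_eq_tensorRep θ a v

lemma untwist_symm_tmul (θ : H →ₐ[k] Module.End k V) {ι : Type*} {a : H} (r : Repr k a ι) (v : V) :
    (untwist θ).symm (a ⊗ₜ v) = ∑ i ∈ r.index, r.left i ⊗ₜ θ (antipode k (r.right i)) v :=
  comulTwist_tmul _ r v

/-- `untwist θ` carries left multiplication to the diagonal action. -/
lemma untwist_mul (θ : H →ₐ[k] Module.End k V) (h : H) (x : H ⊗[k] V) :
    untwist θ ((LinearMap.mulLeft k h).rTensor V x) =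
      tensorRep (Algebra.lmul k H) θ h (untwist θ x) := by
  induction x with
  | zero => simp
  | add x y hx hy => simp only [map_add, hx, hy]
  | tmul a v =>
    rw [untwist_tmul, LinearMap.rTensor_tmul, untwist_tmul, LinearMap.mulLeft_apply, map_mul,
      Module.End.mul_apply]

end HopfTwist

/-! ### The homomorphisms H → Hᵉ → H -/

section Enveloping

open Coalgebra HopfAlgebra

variable (k : Type u) [Field k] (H : Type u) [Ring H] [HopfAlgebra k H]

/-- The algebra homomorphism `H → Hᵉ`, `h ↦ h₍₁₎ ⊗ S(h₍₂₎)`. -/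
def adjointHom : H →ₐ[k] EnvelopingAlgebra k H :=
  (Algebra.TensorProduct.map (AlgHom.id k H) (antipodeAlgHomOp k H)).comp
    (Bialgebra.comulAlgHom k H)

variable {H} in
lemma adjointHom_apply {ι : Type*} {h : H} (r : Repr k h ι) :
    adjointHom k H h = ∑ i ∈ r.index, r.left i ⊗ₜ op (antipode k (r.right i)) := by
  simp [adjointHom, ← r.eq, antipodeAlgHomOp]

/-- The counit as a homomorphism on the opposite algebra. -/
def counitOp : Hᵐᵒᵖ →ₐ[k] k :=
  (Bialgebra.counitAlgHom k H).fromOpposite fun _ _ => Commute.all _ _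

/-- The algebra homomorphism `Hᵉ → H`, `a ⊗ b ↦ ε(b) a`. -/
def counitRight : EnvelopingAlgebra k H →ₐ[k] H :=
  Algebra.TensorProduct.lift (AlgHom.id k H) ((Algebra.ofId k H).comp (counitOp k H))
    fun _ _ => Algebra.commute_algebraMap_right _ _

variable {H}

lemma counitRight_tmul (a : H) (b : Hᵐᵒᵖ) :
    counitRight k H (a ⊗ₜ b) = (counit (R := k) b.unop) • a := by
  simp [counitRight, counitOp, Algebra.ofId_apply, Algebra.smul_def, Algebra.commutes]

/-- From h₁ ε(S(h₂)) = h₁ ε(h₂) = h. Any H-module, made a bimodule with trivial right action, thus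
recovers its own action as the adjoint one; Ext_H(k, M) becomes an Ext of bimodules for every M. -/
lemma counitRight_adjointHom (h : H) : counitRight k H (adjointHom k H h) = h := by
  let r := Repr.arbitrary k h
  rw [adjointHom_apply k r, map_sum]
  simp_rw [counitRight_tmul, unop_op, counit_antipode]
  exact r.sum_counit_right_smul

lemma envelopingDiagonal_smul (a b : H) (x : envelopingDiagonal k H) :
    ((a ⊗ₜ[k] op b : EnvelopingAlgebra k H) • x : envelopingDiagonal k H) =
      (show H from a * (show H from x) * b) := by
  let := instModuleTensorProductMop k H
  change a • op b • (show H from x) = _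
  rw [MulOpposite.smul_eq_mul_unop, smul_eq_mul, mul_assoc]; rfl

end Enveloping

/-! ### Tensor-hom adjunction for representations of H -/

section Functors

open Coalgebra HopfAlgebra ModuleCat

lemma ModuleCat.preservesFinite_of_exact {A B : Type u} [Ring A] [Ring B]
    (F : ModuleCat.{u} A ⥤ ModuleCat.{u} B) [F.Additive]
    (hF : ∀ S : ShortComplex (ModuleCat.{u} A), Function.Exact S.f.hom S.g.hom →
      Function.Exact (F.map S.f).hom (F.map S.g).hom) :
    Limits.PreservesFiniteLimits F ∧ Limits.PreservesFiniteColimits F :=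
  ((Functor.exact_tfae F).out 1 3).mp fun S hS => by
    rw [ShortComplex.ShortExact.moduleCat_exact_iff_function_exact] at hS ⊢
    exact hF S hS

section OfRep

variable {k : Type u} [Field k] {A : Type u} [Ring A] [Algebra k A]
  {X : Type u} [AddCommGroup X] [Module k X]

/-- The module attached to a representation. -/
def ModuleCat.ofRep (φ : A →ₐ[k] Module.End k X) : ModuleCat.{u} A :=
  letI := Module.compHom X (φ : A →+* Module.End k X)
  ModuleCat.of A X

/-- The underlying vector space of the module attached to a representation. -/
def ModuleCat.ofRepEquiv (φ : A →ₐ[k] Module.End k X) : X ≃ₗ[k] ModuleCat.ofRep φ where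
  toFun x := x
  invFun x := x
  map_add' _ _ := rfl
  map_smul' c x := by
    change c • x = φ (algebraMap k A c) x
    simp
  left_inv _ := rfl
  right_inv _ := rfl

lemma ModuleCat.smul_ofRepEquiv (φ : A →ₐ[k] Module.End k X) (a : A) (x : X) :
    a • ofRepEquiv φ x = ofRepEquiv φ (φ a x) := rfl

/-- The representation attached to a module. -/
def ModuleCat.rep (k : Type u) [Field k] {A : Type u} [Ring A] [Algebra k A] (M : ModuleCat.{u} A) :
    A →ₐ[k] Module.End k M :=
  Algebra.lsmul k k M

lemma ModuleCat.rep_apply (M : ModuleCat.{u} A) (a : A) (m : M) : rep k M a m = a • m := rfl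

/-- The linear map over the base field underlying a morphism. -/
def ModuleCat.linHom (k : Type u) [Field k] {A : Type u} [Ring A] [Algebra k A]
    {M N : ModuleCat.{u} A} (f : M ⟶ N) : M →ₗ[k] N :=
  f.hom.restrictScalars k

lemma ModuleCat.linHom_apply {M N : ModuleCat.{u} A} (f : M ⟶ N) (m : M) :
    linHom k f m = f.hom m := rfl

/-- Morphisms out of the module attached to a representation. -/
def ModuleCat.ofRepDesc {φ : A →ₐ[k] Module.End k X} {N : ModuleCat.{u} A} (f : X →ₗ[k] N)
    (hf : ∀ a x, f (φ a x) = a • f x) : ofRep φ ⟶ N :=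
  ModuleCat.ofHom (X := ofRep φ)
    { toFun := fun x => f x
      map_add' := fun x y => f.map_add x y
      map_smul' := hf }

/-- Morphisms into the module attached to a representation. -/
def ModuleCat.ofRepLift {φ : A →ₐ[k] Module.End k X} {N : ModuleCat.{u} A} (f : N →ₗ[k] X)
    (hf : ∀ (a : A) (x : N), f (a • x) = φ a (f x)) : N ⟶ ofRep φ :=
  ModuleCat.ofHom (Y := ofRep φ)
    { toFun := fun x => ofRepEquiv φ (f x)
      map_add' := fun x y => f.map_add x y
      map_smul' := hf }

lemma ModuleCat.ofRep_tensor_hom_ext {Y : Type u} [AddCommGroup Y] [Module k Y]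
    {φ : A →ₐ[k] Module.End k (X ⊗[k] Y)} {N : ModuleCat.{u} A} {f g : ofRep φ ⟶ N}
    (h : ∀ x y, f.hom (ofRepEquiv φ (x ⊗ₜ y)) = g.hom (ofRepEquiv φ (x ⊗ₜ y))) : f = g := by
  ext z
  obtain ⟨z, rfl⟩ := (ofRepEquiv φ).surjective z
  induction z with
  | zero => simp
  | add x y hx hy => simp only [map_add, hx, hy]
  | tmul x y => exact h x y

end OfRep

variable {k : Type u} [Field k] {H : Type u} [Ring H] [HopfAlgebra k H]

/-- Coassociativity, then the antipode axiom on the last two factors. This identity makes the units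
of both adjunctions below equivariant; its companion `sum_tmul_antipode_mul` does the same for the
counits. -/
lemma Coalgebra.Repr.sum_tmul_mul_antipode {ι : Type*} {κ : ι → Type*} {h : H} (r : Repr k h ι)
    (r₁ : ∀ i, Repr k (r.left i) (κ i)) :
    ∑ i ∈ r.index, ∑ j ∈ (r₁ i).index,
      (r₁ i).left j ⊗ₜ[k] ((r₁ i).right j * antipode k (r.right i)) = h ⊗ₜ 1 := by
  let r₂ := fun i => Repr.arbitrary k (r.right i)
  have key := sum_tmul_tmul_eq r r₁ r₂
  have := congr((LinearMap.mul' k H ∘ₗ (antipode k).lTensor H).lTensor H $key)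
  simp only [map_sum, LinearMap.lTensor_tmul, LinearMap.comp_apply, LinearMap.mul'_apply] at this
  rw [this]
  simp_rw [← TensorProduct.tmul_sum, sum_mul_antipode_eq_smul, ← TensorProduct.smul_tmul,
    ← TensorProduct.sum_tmul, r.sum_counit_right_smul]

lemma Coalgebra.Repr.sum_tmul_antipode_mul {ι : Type*} {κ : ι → Type*} {h : H} (r : Repr k h ι)
    (r₁ : ∀ i, Repr k (r.left i) (κ i)) :
    ∑ i ∈ r.index, ∑ j ∈ (r₁ i).index,
      (r₁ i).left j ⊗ₜ[k] (antipode k ((r₁ i).right j) * r.right i) = h ⊗ₜ 1 := by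
  let r₂ := fun i => Repr.arbitrary k (r.right i)
  have key := sum_tmul_tmul_eq r r₁ r₂
  have := congr((LinearMap.mul' k H ∘ₗ (antipode k).rTensor H).lTensor H $key)
  simp only [map_sum, LinearMap.lTensor_tmul, LinearMap.rTensor_tmul, LinearMap.comp_apply,
    LinearMap.mul'_apply] at this
  rw [this]
  simp_rw [← TensorProduct.tmul_sum, sum_antipode_mul_eq_smul, ← TensorProduct.smul_tmul,
    ← TensorProduct.sum_tmul, r.sum_counit_right_smul]

section TensorHom

variable {V : Type u} [AddCommGroup V] [Module k V] (θ : H →ₐ[k] Module.End k V)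

/-- The functor `M ↦ M ⊗ V` on `H`-modules, with the diagonal action. -/
def tensorFunctor : ModuleCat.{u} H ⥤ ModuleCat.{u} H where
  obj M := ofRep (tensorRep (rep k M) θ)
  map {M N} f := ofRepDesc ((ofRepEquiv _).toLinearMap ∘ₗ (linHom k f).rTensor V) (by
    intro a x
    rw [LinearMap.comp_apply, LinearMap.comp_apply, LinearEquiv.coe_coe, smul_ofRepEquiv]
    congr 1
    induction x with
    | zero => simp
    | add x y hx hy => simp only [map_add, hx, hy]
    | tmul m v =>
      let r := Repr.arbitrary k a
      rw [LinearMap.rTensor_tmul, tensorRep_apply _ _ r, tensorRep_apply _ _ r, map_sum]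
      simp_rw [LinearMap.rTensor_tmul, rep_apply, linHom_apply, map_smul])
  map_id M := by
    ext x
    exact congr($(LinearMap.rTensor_id V M) x)
  map_comp {M N P} f g := by
    ext x
    exact congr($(LinearMap.rTensor_comp V (linHom k g) (linHom k f)) x)

instance : (tensorFunctor θ).Additive where
  map_add {M N f g} := by
    ext x
    exact congr($(LinearMap.rTensor_add V (linHom k f) (linHom k g)) x)

lemma tensorFunctor_exact : Limits.PreservesFiniteLimits (tensorFunctor θ) ∧
    Limits.PreservesFiniteColimits (tensorFunctor θ) :=
  preservesFinite_of_exact _ fun S hS =>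
    Module.Flat.rTensor_exact V (f := linHom k S.f) (g := linHom k S.g) hS

instance : Limits.PreservesFiniteLimits (tensorFunctor θ) := (tensorFunctor_exact θ).1

instance : Limits.PreservesFiniteColimits (tensorFunctor θ) := (tensorFunctor_exact θ).2

variable (k V) in
/-- The representation of `A` on `Hom(V, N)` by postcomposition. -/
def postcompRep {A : Type u} [Ring A] [Algebra k A] (N : ModuleCat.{u} A) :
    A →ₐ[k] Module.End k (V →ₗ[k] N) :=
  AlgHom.ofLinearMap (LinearMap.llcomp k V N N ∘ₗ (rep k N).toLinearMap)
    (by ext; simp) (by intro a b; ext; simp)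

/-- The representation of `Hᵒᵖ` on `Hom(V, N)` by precomposition. -/
def precompRep (N : Type u) [AddCommGroup N] [Module k N] :
    Hᵐᵒᵖ →ₐ[k] Module.End k (V →ₗ[k] N) :=
  AlgHom.ofLinearMap ((LinearMap.llcomp k V V N).flip ∘ₗ θ.toLinearMap ∘ₗ
      (opLinearEquiv k).symm.toLinearMap)
    (by ext; simp) (by intro a b; ext; simp)

/-- The representation of `H` on `Hom(V, N)`, `(h f)(v) = h₍₁₎ f(S(h₍₂₎) v)`. -/
def homRep (N : ModuleCat.{u} H) : H →ₐ[k] Module.End k (V →ₗ[k] N) :=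
  (Algebra.TensorProduct.lift (postcompRep k V N) (precompRep θ N)
    (by intro a b; ext; simp [postcompRep, precompRep])).comp (adjointHom k H)

lemma homRep_apply (N : ModuleCat.{u} H) {ι : Type*} {h : H} (r : Repr k h ι) (f : V →ₗ[k] N)
    (v : V) :
    homRep θ N h f v = ∑ i ∈ r.index, r.left i • f (θ (antipode k (r.right i)) v) := by
  rw [homRep, AlgHom.comp_apply, adjointHom_apply k r, map_sum, LinearMap.sum_apply,
    LinearMap.sum_apply]
  rfl

/-- The functor `N ↦ Hom(V, N)` on `H`-modules. -/
def homFunctor : ModuleCat.{u} H ⥤ ModuleCat.{u} H where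
  obj N := ofRep (homRep θ N)
  map {M N} f := ofRepDesc ((ofRepEquiv _).toLinearMap ∘ₗ LinearMap.llcomp k V M N (linHom k f)) (by
    intro a x
    rw [LinearMap.comp_apply, LinearMap.comp_apply, LinearEquiv.coe_coe, smul_ofRepEquiv]
    congr 1
    ext v
    let r := Repr.arbitrary k a
    rw [LinearMap.llcomp_apply, homRep_apply _ _ r, homRep_apply _ _ r, map_sum]
    simp_rw [LinearMap.llcomp_apply, linHom_apply, map_smul])
  map_id M := rfl
  map_comp {M N P} f g := rfl

instance : (homFunctor θ).Additive where
  map_add {M N f g} := by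
    rfl

lemma homFunctor_exact : Limits.PreservesFiniteLimits (homFunctor θ) ∧
    Limits.PreservesFiniteColimits (homFunctor θ) := by
  refine preservesFinite_of_exact _ fun S hS => fun (x : V →ₗ[k] S.X₂) => ?_
  constructor
  · intro hx
    have hx' : ∀ v, x v ∈ LinearMap.range (linHom k S.f) := fun v =>
      (hS _).1 congr($(show (linHom k S.g) ∘ₗ x = 0 from hx) v)
    obtain ⟨y, hy⟩ := Module.projective_lifting_property (linHom k S.f).rangeRestrict
      (x.codRestrict _ hx') (LinearMap.surjective_rangeRestrict _)
    refine ⟨(y : V →ₗ[k] S.X₁), ?_⟩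
    exact LinearMap.ext fun v => congr($(LinearMap.congr_fun hy v).1)
  · rintro ⟨y, rfl⟩
    exact LinearMap.ext fun v => (hS _).2 ⟨_, rfl⟩

instance : Limits.PreservesFiniteLimits (homFunctor θ) := (homFunctor_exact θ).1

instance : Limits.PreservesFiniteColimits (homFunctor θ) := (homFunctor_exact θ).2

instance : (homFunctor θ).Linear k where
  map_smul {M N} f c := by
    ext x
    exact ((ofRepEquiv (homRep θ N)).map_smul c (linHom k f ∘ₗ x : V →ₗ[k] N))

/-- The map `M → Hom(V, M ⊗ V)`. -/
def tensorHomUnit (M : ModuleCat.{u} H) : M ⟶ ofRep (homRep θ (ofRep (tensorRep (rep k M) θ))) :=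
  ofRepLift (LinearMap.llcomp k V _ _ (ofRepEquiv (tensorRep (rep k M) θ)).toLinearMap ∘ₗ
    TensorProduct.mk k M V) (by
      intro h m
      ext v
      let r := Repr.arbitrary k h
      let r₁ := fun i => Repr.arbitrary k (r.left i)
      rw [homRep_apply _ _ r]
      simp_rw [LinearMap.comp_apply, LinearMap.llcomp_apply, LinearEquiv.coe_coe, smul_ofRepEquiv,
        ← map_sum]
      congr 1
      simp_rw [TensorProduct.mk_apply, fun i => tensorRep_apply (rep k M) θ (r₁ i)]
      have := congr(TensorProduct.map ((rep k M).toLinearMap.flip m)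
        (θ.toLinearMap.flip v) $(r.sum_tmul_mul_antipode r₁))
      simpa [rep_apply] using this.symm)

/-- The evaluation map `Hom(V, N) ⊗ V → N`. -/
def tensorHomCounit (N : ModuleCat.{u} H) :
    ofRep (tensorRep (rep k (ofRep (homRep θ N))) θ) ⟶ N :=
  ofRepDesc (TensorProduct.lift (ofRepEquiv (homRep θ N)).symm.toLinearMap) (by
    intro h x
    induction x with
    | zero => simp
    | add x y hx hy => simp only [map_add, smul_add, hx, hy]
    | tmul f v =>
      obtain ⟨f, rfl⟩ := (ofRepEquiv (homRep θ N)).surjective f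
      let r := Repr.arbitrary k h
      let r₁ := fun i => Repr.arbitrary k (r.left i)
      rw [tensorRep_apply _ _ r, map_sum]
      simp_rw [rep_apply, smul_ofRepEquiv]
      simp only [TensorProduct.lift.tmul, LinearEquiv.coe_coe, LinearEquiv.symm_apply_apply]
      simp_rw [fun i => homRep_apply θ N (r₁ i)]
      have := congr(TensorProduct.lift ((rep k N).toLinearMap.flip ∘ₗ f ∘ₗ
        θ.toLinearMap.flip v).flip $(r.sum_tmul_antipode_mul r₁))
      simpa [rep_apply] using this)

/-- The tensor-hom adjunction for modules over a Hopf algebra. -/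
def tensorHomAdj : tensorFunctor θ ⊣ homFunctor θ where
  unit :=
    { app := tensorHomUnit θ
      naturality := fun _ _ _ => rfl }
  counit :=
    { app := tensorHomCounit θ
      naturality := fun _ _ _ => ofRep_tensor_hom_ext fun _ _ => rfl }
  left_triangle_components _ := ofRep_tensor_hom_ext fun _ _ => rfl
  right_triangle_components _ := rfl

end TensorHom

end Functors

/-! ### The adjunction between H-modules and bimodules -/

section EnvelopingAdjunction

open Coalgebra HopfAlgebra ModuleCat

variable {k : Type u} [Field k] {H : Type u} [Ring H] [HopfAlgebra k H]

/-- The representation of `Hᵉ` on `M ⊗ H`, diagonal on the left and by right multiplication on `H`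
on the right. -/
def bimoduleRep (M : ModuleCat.{u} H) :
    EnvelopingAlgebra k H →ₐ[k] Module.End k (M ⊗[k] H) :=
  Algebra.TensorProduct.lift (tensorRep (rep k M) (Algebra.lmul k H))
    ((Module.endTensorEndAlgHom (R := k) (S := k) (A := k) (M := M) (N := H)).comp
      (Algebra.TensorProduct.includeRight.comp (Algebra.lsmul k k H : Hᵐᵒᵖ →ₐ[k] Module.End k H)))
    (by
      intro a b
      refine TensorProduct.ext' fun m h => ?_
      let r := Repr.arbitrary k a
      have hb (x : H) (m : M) : (Module.endTensorEndAlgHom (R := k) (S := k) (A := k) (M := M)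
        (N := H)).comp (Algebra.TensorProduct.includeRight.comp
          (Algebra.lsmul k k H : Hᵐᵒᵖ →ₐ[k] Module.End k H)) b (m ⊗ₜ x) = m ⊗ₜ (b • x) := rfl
      rw [Module.End.mul_apply, Module.End.mul_apply, hb, tensorRep_apply _ _ r,
        tensorRep_apply _ _ r, map_sum]
      simp_rw [hb]
      simp [mul_assoc])

lemma bimoduleRep_apply (M : ModuleCat.{u} H) {ι : Type*} {a : H} (r : Repr k a ι) (b : Hᵐᵒᵖ)
    (m : M) (h : H) :
    bimoduleRep M (a ⊗ₜ b) (m ⊗ₜ[k] h) =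
      ∑ i ∈ r.index, (r.left i • m) ⊗ₜ (r.right i * h * b.unop) := by
  change tensorRep (rep k M) (Algebra.lmul k H) a (m ⊗ₜ (h * b.unop)) = _
  rw [tensorRep_apply _ _ r]
  simp [rep_apply, mul_assoc]

lemma bimoduleRep_one_tmul (M : ModuleCat.{u} H) (b : Hᵐᵒᵖ) (m : M) (h : H) :
    bimoduleRep M (1 ⊗ₜ b) (m ⊗ₜ[k] h) = m ⊗ₜ (h * b.unop) := by
  change tensorRep (rep k M) (Algebra.lmul k H) 1 (m ⊗ₜ (h * b.unop)) = _
  rw [map_one, Module.End.one_apply]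

section Restriction

/-- Morphisms of modules from linear maps over the base field. -/
def ModuleCat.homOfLin {A : Type u} [Ring A] [Algebra k A] {M N : ModuleCat.{u} A} (f : M →ₗ[k] N)
    (hf : ∀ (a : A) (m : M), f (a • m) = a • f m) : M ⟶ N :=
  ModuleCat.ofHom
    { toFun := f
      map_add' := f.map_add
      map_smul' := hf }

variable {A B : Type u} [Ring A] [Ring B] [Algebra k A] [Algebra k B] (f : A →ₐ[k] B)

/-- Restriction of modules along a homomorphism of `k`-algebras. -/
def resFunctor : ModuleCat.{u} B ⥤ ModuleCat.{u} A where
  obj N := ofRep ((rep k N).comp f)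
  map {M N} g := ofRepDesc ((ofRepEquiv _).toLinearMap ∘ₗ linHom k g) (by
    intro a x
    rw [LinearMap.comp_apply, LinearMap.comp_apply, LinearEquiv.coe_coe, smul_ofRepEquiv]
    congr 1
    exact g.hom.map_smul _ _)
  map_id M := rfl
  map_comp {M N P} f g := rfl

instance : (resFunctor f).Additive where
  map_add := rfl

lemma resFunctor_exact : Limits.PreservesFiniteLimits (resFunctor f) ∧
    Limits.PreservesFiniteColimits (resFunctor f) :=
  preservesFinite_of_exact _ fun _ hS => hS

instance : Limits.PreservesFiniteLimits (resFunctor f) := (resFunctor_exact f).1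

instance : Limits.PreservesFiniteColimits (resFunctor f) := (resFunctor_exact f).2

instance : (resFunctor f).Linear k where
  map_smul {M N} g c := by
    ext x
    exact (ofRepEquiv ((rep k N).comp f)).map_smul c (linHom k g x)

end Restriction

/-- The left side is h₁ m ⊗ h₂ S(h₃). This is the linearity of `bimoduleUnit`. -/
lemma adjointHom_bimoduleRep (M : ModuleCat.{u} H) (h : H) (m : M) :
    bimoduleRep M (adjointHom k H h) (m ⊗ₜ[k] (1 : H)) = (h • m) ⊗ₜ (1 : H) := by
  let r := Repr.arbitrary k h
  let r₁ := fun i => Repr.arbitrary k (r.left i)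
  rw [adjointHom_apply k r, map_sum, LinearMap.sum_apply]
  simp_rw [fun i => bimoduleRep_apply (k := k) M (r₁ i)]
  have := congr(((rep k M).toLinearMap.flip m).rTensor H $(r.sum_tmul_mul_antipode r₁))
  simpa [rep_apply] using this

variable {E : Type u} [Ring E] [Algebra k E] (e : EnvelopingAlgebra k H ≃ₐ[k] E)

/-- The representation `bimoduleRep`, transported to an algebra `E` isomorphic to `Hᵉ`. -/
def bimoduleRep' (M : ModuleCat.{u} H) : E →ₐ[k] Module.End k (M ⊗[k] H) :=
  (bimoduleRep M).comp e.symm.toAlgHom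

lemma bimoduleRep'_apply (M : ModuleCat.{u} H) (a : EnvelopingAlgebra k H) (x : M ⊗[k] H) :
    bimoduleRep' e M (e a) x = bimoduleRep M a x := by
  simp [bimoduleRep']

/-- The homomorphism `adjointHom`, transported to an algebra `E` isomorphic to `Hᵉ`. -/
def adjointHom' : H →ₐ[k] E := e.toAlgHom.comp (adjointHom k H)

lemma adjointHom'_apply (h : H) : adjointHom' e h = e (adjointHom k H h) := rfl

/-- The right action of `H` on an `Hᵉ`-module. -/
def rightMul (N : ModuleCat.{u} E) : N →ₗ[k] H →ₗ[k] N :=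
  ((rep k N).toLinearMap ∘ₗ e.toAlgHom.toLinearMap ∘ₗ
    Algebra.TensorProduct.includeRight.toLinearMap ∘ₗ (opLinearEquiv k).toLinearMap).flip

lemma rightMul_apply (N : ModuleCat.{u} E) (n : N) (h : H) :
    rightMul e N n h = e (1 ⊗ₜ[k] op h) • n := rfl

lemma rightMul_one (N : ModuleCat.{u} E) (n : N) : rightMul e N n 1 = n := by
  rw [rightMul_apply, op_one, ← Algebra.TensorProduct.one_def, map_one, one_smul]

lemma bimoduleRep'_one_tmul (M : ModuleCat.{u} H) (m : M) (h x : H) :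
    bimoduleRep' e M (e (1 ⊗ₜ op h)) (m ⊗ₜ[k] x) = m ⊗ₜ (x * h) := by
  rw [bimoduleRep'_apply, bimoduleRep_one_tmul, unop_op]

/-- The functor `M ↦ M ⊗ H` from `H`-modules to `Hᵉ`-modules. -/
def bimoduleFunctor : ModuleCat.{u} H ⥤ ModuleCat.{u} E where
  obj M := ofRep (bimoduleRep' e M)
  map {M N} f := ofRepDesc ((ofRepEquiv _).toLinearMap ∘ₗ (linHom k f).rTensor H) (by
    intro a x
    rw [LinearMap.comp_apply, LinearMap.comp_apply, LinearEquiv.coe_coe, smul_ofRepEquiv]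
    congr 1
    obtain ⟨a, rfl⟩ := e.surjective a
    rw [bimoduleRep'_apply, bimoduleRep'_apply]
    induction x with
    | zero => simp
    | add x y hx hy => simp only [map_add, hx, hy]
    | tmul m v =>
      induction a using TensorProduct.induction_on with
      | zero => simp
      | add a b ha hb => simp only [map_add, LinearMap.add_apply, ha, hb]
      | tmul a b =>
        let r := Repr.arbitrary k a
        rw [LinearMap.rTensor_tmul, bimoduleRep_apply _ r, bimoduleRep_apply _ r, map_sum]
        simp_rw [LinearMap.rTensor_tmul, linHom_apply, map_smul])
  map_id M := ofRep_tensor_hom_ext fun _ _ => rfl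
  map_comp {M N P} f g := ofRep_tensor_hom_ext fun _ _ => rfl

instance : (bimoduleFunctor e).Additive where
  map_add {M N f g} := by
    ext x
    exact congr($(LinearMap.rTensor_add H (linHom k f) (linHom k g)) x)

lemma bimoduleFunctor_exact : Limits.PreservesFiniteLimits (bimoduleFunctor e) ∧
    Limits.PreservesFiniteColimits (bimoduleFunctor e) :=
  preservesFinite_of_exact _ fun S hS =>
    Module.Flat.rTensor_exact H (f := linHom k S.f) (g := linHom k S.g) hS

instance : Limits.PreservesFiniteLimits (bimoduleFunctor e) := (bimoduleFunctor_exact e).1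

instance : Limits.PreservesFiniteColimits (bimoduleFunctor e) := (bimoduleFunctor_exact e).2

/-- The functor from `Hᵉ`-modules to `H`-modules given by the adjoint action,
`h • n = h₍₁₎ n S(h₍₂₎)`. -/
abbrev adjointFunctor : ModuleCat.{u} E ⥤ ModuleCat.{u} H := resFunctor (adjointHom' e)

/-- The map `M → M ⊗ H`, `m ↦ m ⊗ 1`. -/
def bimoduleUnit (M : ModuleCat.{u} H) :
    M ⟶ ofRep ((rep k (ofRep (bimoduleRep' e M))).comp (adjointHom' e)) :=
  ofRepLift ((ofRepEquiv (bimoduleRep' e M)).toLinearMap ∘ₗ (TensorProduct.mk k M H).flip 1) (by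
    intro h m
    rw [LinearMap.comp_apply, LinearMap.comp_apply, LinearEquiv.coe_coe, AlgHom.comp_apply,
      rep_apply, smul_ofRepEquiv, LinearMap.flip_apply, LinearMap.flip_apply,
      TensorProduct.mk_apply, TensorProduct.mk_apply, adjointHom'_apply, bimoduleRep'_apply,
      adjointHom_bimoduleRep])

/-- The map `N ⊗ H → N`, `n ⊗ h ↦ n h`. -/
def bimoduleCounit (N : ModuleCat.{u} E) :
    ofRep (bimoduleRep' e (ofRep ((rep k N).comp (adjointHom' e)))) ⟶ N :=
  ofRepDesc (TensorProduct.lift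
      (rightMul e N ∘ₗ (ofRepEquiv ((rep k N).comp (adjointHom' e))).symm.toLinearMap)) (by
    intro a x
    obtain ⟨a, rfl⟩ := e.surjective a
    rw [bimoduleRep'_apply]
    induction x with
    | zero => simp
    | add x y hx hy => simp only [map_add, smul_add, hx, hy]
    | tmul n h =>
      obtain ⟨n, rfl⟩ := (ofRepEquiv ((rep k N).comp (adjointHom' e))).surjective n
      rw [TensorProduct.lift.tmul, LinearMap.comp_apply, LinearEquiv.coe_coe,
        LinearEquiv.symm_apply_apply, rightMul_apply]
      induction a using TensorProduct.induction_on with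
      | zero => rw [map_zero, map_zero, LinearMap.zero_apply, map_zero, zero_smul]
      | add a b ha hb =>
        rw [map_add, map_add, LinearMap.add_apply, map_add, ha, hb, add_smul]
      | tmul a b =>
        let r := Repr.arbitrary k a
        let r₁ := fun i => Repr.arbitrary k (r.left i)
        rw [bimoduleRep_apply _ r, map_sum]
        simp_rw [smul_ofRepEquiv, TensorProduct.lift.tmul, LinearMap.comp_apply,
          LinearEquiv.coe_coe, LinearEquiv.symm_apply_apply, rightMul_apply, AlgHom.comp_apply,
          rep_apply, adjointHom'_apply, ← mul_smul, ← map_mul, ← Finset.sum_smul, ← map_sum]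
        congr 2
        simp_rw [fun i => adjointHom_apply k (r₁ i), Finset.mul_sum]
        have := congr(((opLinearEquiv k).toLinearMap ∘ₗ LinearMap.mulRight k b.unop ∘ₗ
          LinearMap.mulRight k h).lTensor H $(r.sum_tmul_antipode_mul r₁))
        simpa [mul_assoc] using this)

/-- The functor `M ↦ M ⊗ H` is left adjoint to the adjoint action functor. -/
def bimoduleAdj : bimoduleFunctor e ⊣ adjointFunctor e where
  unit :=
    { app := bimoduleUnit e
      naturality := fun _ _ _ => rfl }
  counit :=
    { app := bimoduleCounit e
      naturality := fun M N f => ofRep_tensor_hom_ext fun n h =>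
        (f.hom.map_smul (e (1 ⊗ₜ[k] op h))
          ((ofRepEquiv ((rep k M).comp (adjointHom' e))).symm n)).symm }
  left_triangle_components M := ofRep_tensor_hom_ext fun m h => by
    have : rightMul e (ofRep (bimoduleRep' e M))
        (ofRepEquiv (bimoduleRep' e M) (m ⊗ₜ (1 : H))) h =
          ofRepEquiv (bimoduleRep' e M) (m ⊗ₜ h) := by
      rw [rightMul_apply, smul_ofRepEquiv, bimoduleRep'_one_tmul, one_mul]
    exact this
  right_triangle_components N := by
    ext n
    exact congrArg (ofRepEquiv ((rep k N).comp (adjointHom' e)))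
      (rightMul_one e N ((ofRepEquiv ((rep k N).comp (adjointHom' e))).symm n))

end EnvelopingAdjunction

/-! ### Trivial modules, regular modules and diagonal modules -/

section TrivialModules

open Coalgebra HopfAlgebra ModuleCat

section OfRepIso

variable {k : Type u} [Field k] {A : Type u} [Ring A] [Algebra k A]
  {X : Type u} [AddCommGroup X] [Module k X]

/-- An equivariant linear equivalence as an isomorphism of modules. -/
def ModuleCat.ofRepIso {φ : A →ₐ[k] Module.End k X} {N : ModuleCat.{u} A} (f : X ≃ₗ[k] N)
    (hf : ∀ a x, f (φ a x) = a • f x) : ofRep φ ≅ N where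
  hom := ofRepDesc f.toLinearMap hf
  inv := ofRepLift f.symm.toLinearMap fun a x => f.injective (by
    rw [hf, LinearEquiv.coe_coe, f.apply_symm_apply, f.apply_symm_apply])
  hom_inv_id := by
    ext x
    exact congrArg (ofRepEquiv φ) (f.symm_apply_apply ((ofRepEquiv φ).symm x))
  inv_hom_id := by
    ext x
    exact f.apply_symm_apply x

variable {B : Type u} [Ring B] [Algebra k B]

/-- The unit of `resAdj`. -/
def resUnit (f : A ≃ₐ[k] B) (M : ModuleCat.{u} A) :
    M ⟶ ofRep ((rep k (ofRep ((rep k M).comp f.symm.toAlgHom))).comp f.toAlgHom) :=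
  ofRepLift (ofRepEquiv ((rep k M).comp f.symm.toAlgHom)).toLinearMap (by
    intro a x
    rw [LinearEquiv.coe_coe, AlgHom.comp_apply, rep_apply, smul_ofRepEquiv]
    simp [rep_apply])

/-- The counit of `resAdj`. -/
def resCounit (f : A ≃ₐ[k] B) (N : ModuleCat.{u} B) :
    ofRep ((rep k (ofRep ((rep k N).comp f.toAlgHom))).comp f.symm.toAlgHom) ⟶ N :=
  ofRepDesc (ofRepEquiv ((rep k N).comp f.toAlgHom)).symm.toLinearMap (by
    intro b x
    obtain ⟨x, rfl⟩ := (ofRepEquiv ((rep k N).comp f.toAlgHom)).surjective x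
    rw [AlgHom.comp_apply, rep_apply, smul_ofRepEquiv, LinearEquiv.coe_coe,
      LinearEquiv.symm_apply_apply, LinearEquiv.symm_apply_apply]
    simp [rep_apply])

/-- Restrictions along mutually inverse isomorphisms are adjoint. -/
def resAdj (f : A ≃ₐ[k] B) : resFunctor f.symm.toAlgHom ⊣ resFunctor f.toAlgHom where
  unit :=
    { app := resUnit f
      naturality := fun _ _ _ => rfl }
  counit :=
    { app := resCounit f
      naturality := fun _ _ _ => rfl }
  left_triangle_components _ := rfl
  right_triangle_components _ := rfl

variable (A) in
/-- The regular module. -/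
def regModule : ModuleCat.{u} A := ModuleCat.of A A

variable (k A) in
/-- The underlying vector space of the regular module. -/
def regEquiv : A ≃ₗ[k] regModule A where
  toFun x := x
  invFun x := x
  map_add' _ _ := rfl
  map_smul' c x := Algebra.smul_def c (show A from x)
  left_inv _ := rfl
  right_inv _ := rfl

lemma smul_regEquiv (a x : A) : a • regEquiv k A x = regEquiv k A (a * x) := rfl

variable (k) in
lemma ModuleCat.regModule_hom_ext {M : ModuleCat.{u} A} {f g : regModule A ⟶ M}
    (h : f.hom (regEquiv k A 1) = g.hom (regEquiv k A 1)) : f = g :=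
  ModuleCat.hom_ext (LinearMap.ext_ring h)

lemma ModuleCat.smul_hom_apply {M N : ModuleCat.{u} A} (c : k) (f : M ⟶ N) (x : M) :
    (c • f).hom x = c • f.hom x := rfl

end OfRepIso

variable {k : Type u} [Field k] {H : Type u} [Ring H]

section Bialgebra

variable [Bialgebra k H]

variable (k H) in
/-- The underlying vector space of the left trivial module. -/
def leftTrivialEquiv : k ≃ₗ[k] leftTrivial k H where
  toFun x := x
  invFun x := x
  map_add' _ _ := rfl
  map_smul' c x := by
    change c * x = counit (R := k) (algebraMap k H c) * x
    rw [Bialgebra.counit_algebraMap]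
  left_inv _ := rfl
  right_inv _ := rfl

lemma smul_leftTrivialEquiv (h : H) (x : k) :
    h • leftTrivialEquiv k H x = leftTrivialEquiv k H (counit h * x) := rfl

variable (k H) in
/-- The underlying vector space of the right trivial module. -/
def rightTrivialEquiv : k ≃ₗ[k] rightTrivial k H where
  toFun x := x
  invFun x := x
  map_add' _ _ := rfl
  map_smul' c x := by
    change c * x = counit (R := k) (algebraMap k H c) * x
    rw [Bialgebra.counit_algebraMap]
  left_inv _ := rfl
  right_inv _ := rfl

lemma smul_rightTrivialEquiv (h : Hᵐᵒᵖ) (x : k) :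
    h • rightTrivialEquiv k H x = rightTrivialEquiv k H (counit h.unop * x) := rfl

end Bialgebra

variable [HopfAlgebra k H]

section

variable {E : Type u} [Ring E] [Algebra k E] (e : EnvelopingAlgebra k H ≃ₐ[k] E)
  {D : ModuleCat.{u} E} (i : H ≃ₗ[k] D) (hD : ∀ a b x : H, i (a * x * b) = e (a ⊗ₜ op b) • i x)

include hD in
lemma map_bimoduleRep_leftTrivial (a : E) (x : leftTrivial k H ⊗[k] H) :
    (((leftTrivialEquiv k H).symm.rTensor H ≪≫ₗ TensorProduct.lid k H) ≪≫ₗ i)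
      (bimoduleRep' e (leftTrivial k H) a x) =
    a • (((leftTrivialEquiv k H).symm.rTensor H ≪≫ₗ TensorProduct.lid k H) ≪≫ₗ i) x := by
  obtain ⟨a, rfl⟩ := e.surjective a
  rw [bimoduleRep'_apply]
  induction x with
  | zero => simp
  | add x y hx hy => simp only [map_add, smul_add, hx, hy]
  | tmul c h =>
    obtain ⟨c, rfl⟩ := (leftTrivialEquiv k H).surjective c
    induction a using TensorProduct.induction_on with
    | zero => simp
    | add a b ha hb => simp only [map_add, LinearMap.add_apply, ha, hb, add_smul]
    | tmul a b =>
      let r := Repr.arbitrary k a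
      rw [bimoduleRep_apply _ r, map_sum]
      simp_rw [smul_leftTrivialEquiv, LinearEquiv.trans_apply, LinearEquiv.rTensor_tmul,
        LinearEquiv.symm_apply_apply, TensorProduct.lid_tmul, ← map_sum]
      rw [← op_unop b, map_smul, smul_comm, ← hD, ← map_smul, unop_op]
      congr 1
      have := congr(LinearMap.mulRight k b.unop (LinearMap.mulRight k h $(sum_counit_smul r)))
      simp only [map_sum, map_smul, LinearMap.mulRight_apply] at this
      rw [← this, Finset.smul_sum]
      simp_rw [mul_comm _ c, mul_smul]

/-- `k ⊗ H ≅ H` as bimodules. -/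
def bimoduleTrivialIso : (bimoduleFunctor e).obj (leftTrivial k H) ≅ D :=
  ofRepIso (((leftTrivialEquiv k H).symm.rTensor H ≪≫ₗ TensorProduct.lid k H) ≪≫ₗ i)
    (map_bimoduleRep_leftTrivial e i hD)

end

section

variable {V : Type u} [AddCommGroup V] [Module k V] (θ : H →ₐ[k] Module.End k V)

/-- `k ⊗ V ≅ V`. -/
def tensorTrivialIso : (tensorFunctor θ).obj (leftTrivial k H) ≅ ofRep θ :=
  ofRepIso (((leftTrivialEquiv k H).symm.rTensor V ≪≫ₗ TensorProduct.lid k V) ≪≫ₗ ofRepEquiv θ) (by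
    intro a x
    induction x with
    | zero => simp
    | add x y hx hy => simp only [map_add, smul_add, hx, hy]
    | tmul c v =>
      obtain ⟨c, rfl⟩ := (leftTrivialEquiv k H).surjective c
      let r := Repr.arbitrary k a
      rw [tensorRep_apply _ _ r, map_sum]
      simp_rw [rep_apply, smul_leftTrivialEquiv, LinearEquiv.trans_apply, LinearEquiv.rTensor_tmul,
        LinearEquiv.symm_apply_apply, TensorProduct.lid_tmul, ← map_sum]
      rw [smul_ofRepEquiv]
      congr 1
      have := congr(θ $(sum_counit_smul r) v)
      simp only [map_sum, map_smul, LinearMap.sum_apply, LinearMap.smul_apply] at this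
      rw [map_smul, ← this, Finset.smul_sum]
      simp_rw [mul_comm _ c, mul_smul])

/-- The module `H ⊗ V` with the diagonal action. -/
abbrev diagModule : ModuleCat.{u} H := ofRep (tensorRep (Algebra.lmul k H) θ)

/-- The isomorphism `untwist`, with values in the module `H ⊗ V`. -/
def diagEquiv : H ⊗[k] V ≃ₗ[k] diagModule θ :=
  untwist θ ≪≫ₗ ofRepEquiv (tensorRep (Algebra.lmul k H) θ)

lemma smul_diagEquiv (h : H) (x : H ⊗[k] V) :
    h • diagEquiv θ x = diagEquiv θ ((LinearMap.mulLeft k h).rTensor V x) := by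
  rw [diagEquiv, LinearEquiv.trans_apply, LinearEquiv.trans_apply, smul_ofRepEquiv, untwist_mul]

/-- The morphism `a ↦ a • (1 ⊗ v)` to `H ⊗ V`. -/
def diagIncl (v : V) : regModule H ⟶ diagModule θ :=
  homOfLin ((diagEquiv θ).toLinearMap ∘ₗ (TensorProduct.mk k H V).flip v ∘ₗ
    (regEquiv k H).symm.toLinearMap) (by
      intro a x
      obtain ⟨x, rfl⟩ := (regEquiv k H).surjective x
      simp [smul_regEquiv, smul_diagEquiv])

lemma diagIncl_apply (v : V) (a : H) :
    (diagIncl θ v).hom (regEquiv k H a) = diagEquiv θ (a ⊗ₜ v) := rfl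

/-- The morphism `H ⊗ V → H` that contracts with `f` after untwisting. -/
def diagProj (f : V →ₗ[k] k) : diagModule θ ⟶ regModule H :=
  homOfLin ((regEquiv k H).toLinearMap ∘ₗ (TensorProduct.rid k H).toLinearMap ∘ₗ
    f.lTensor H ∘ₗ (diagEquiv θ).symm.toLinearMap) (by
    intro a x
    obtain ⟨x, rfl⟩ := (diagEquiv θ).surjective x
    rw [smul_diagEquiv]
    simp only [LinearMap.comp_apply, LinearEquiv.coe_coe, LinearEquiv.symm_apply_apply]
    induction x with
    | zero => simp
    | add x y hx hy => simp only [map_add, smul_add, hx, hy]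
    | tmul h v =>
      simp only [LinearMap.rTensor_tmul, LinearMap.mulLeft_apply, LinearMap.lTensor_tmul,
        TensorProduct.rid_tmul]
      rw [smul_regEquiv, mul_smul_comm])

lemma diagProj_apply (f : V →ₗ[k] k) (a : H) (v : V) :
    (diagProj θ f).hom (diagEquiv θ (a ⊗ₜ v)) = regEquiv k H (f v • a) := by
  change regEquiv k H (TensorProduct.rid k H
    (f.lTensor H ((diagEquiv θ).symm (diagEquiv θ (a ⊗ₜ v))))) = _
  rw [LinearEquiv.symm_apply_apply, LinearMap.lTensor_tmul, TensorProduct.rid_tmul]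

lemma diagIncl_comp_diagProj (v : V) (f : V →ₗ[k] k) :
    diagIncl θ v ≫ diagProj θ f = f v • 𝟙 _ :=
  regModule_hom_ext k ((diagProj_apply θ f 1 v).trans (map_smul _ _ _))

lemma diagIncl_add (v w : V) : diagIncl θ (v + w) = diagIncl θ v + diagIncl θ w := by
  refine regModule_hom_ext k ?_
  rw [ModuleCat.hom_add, LinearMap.add_apply]
  simp only [diagIncl_apply, tmul_add, map_add]

lemma diagIncl_smul (c : k) (v : V) : diagIncl θ (c • v) = c • diagIncl θ v := by
  refine regModule_hom_ext k ?_
  rw [diagIncl_apply, tmul_smul, map_smul, smul_hom_apply, diagIncl_apply]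

/-- After untwisting, H ⊗ V is free on a basis of V, and an element involves only finitely many
coordinates. This is the locally finite decomposition of the identity through which Ext into H ⊗ V
reduces to Ext into H. -/
lemma exists_sum_diagProj_comp_diagIncl {ι : Type*} (b : Module.Basis ι k V) (x : diagModule θ) :
    ∃ s : Finset ι, ∀ t, s ⊆ t →
      ∑ j ∈ t, (diagProj θ (b.coord j) ≫ diagIncl θ (b j)).hom x = x := by
  classical
  obtain ⟨x, rfl⟩ := (diagEquiv θ).surjective x
  induction x with
  | zero => exact ⟨∅, fun t _ => by simp only [map_zero, Finset.sum_const_zero]⟩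
  | add x y hx hy =>
    obtain ⟨s, hs⟩ := hx
    obtain ⟨s', hs'⟩ := hy
    refine ⟨s ∪ s', fun t ht => ?_⟩
    simp only [map_add, Finset.sum_add_distrib]
    rw [hs t (Finset.union_subset_left ht), hs' t (Finset.union_subset_right ht)]
  | tmul h v =>
    refine ⟨(b.repr v).support, fun t ht => ?_⟩
    have (j : ι) : (diagProj θ (b.coord j) ≫ diagIncl θ (b j)).hom (diagEquiv θ (h ⊗ₜ v)) =
        diagEquiv θ (h ⊗ₜ (b.repr v j • b j)) := by
      rw [ModuleCat.hom_comp, LinearMap.comp_apply, diagProj_apply, diagIncl_apply, smul_tmul,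
        Module.Basis.coord_apply]
    rw [Finset.sum_congr rfl fun j _ => this j, ← map_sum, ← tmul_sum]
    congr 2
    conv_rhs => rw [← b.linearCombination_repr v, Finsupp.linearCombination_apply]
    exact (Finsupp.sum_of_support_subset _ ht (fun j a => a • b j) fun _ _ => zero_smul k _).symm

end

end TrivialModules

/-! ### Ext commuting with direct sums, and projective dimension -/

section LocallyFiniteExt

variable {R : Type u} [Ring R]

/-- Every extension of `X` by `N` is a finite sum of its composites with a locally finite family of
endomorphisms of `N` with sum the identity. -/
def ModuleCat.HasLocallyFiniteExt (X : ModuleCat.{u} R) : Prop :=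
  ∀ ⦃N : ModuleCat.{u} R⦄ ⦃J : Type u⦄ (q : J → (N ⟶ N)),
    (∀ x : N, ∃ s : Finset J, ∀ t, s ⊆ t → ∑ j ∈ t, (q j).hom x = x) →
      ∀ ⦃n : ℕ⦄ (x : Ext.{u} X N n), ∃ t : Finset J, x = ∑ j ∈ t, x.comp (Ext.mk₀ (q j)) (add_zero n)

/-- The coordinate endomorphisms of a free module sum to the identity, and each factors through R.
-/
lemma ModuleCat.HasLocallyFiniteExt.eq_zero_of_regular {X : ModuleCat.{u} R}
    (hX : X.HasLocallyFiniteExt) {n : ℕ} (h : ∀ x : Ext.{u} X (ModuleCat.of R R) n, x = 0)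
    (J : Type u) (x : Ext.{u} X (ModuleCat.of R (J →₀ R)) n) : x = 0 := by
  classical
  let ι (j : J) : ModuleCat.of R R ⟶ ModuleCat.of R (J →₀ R) := ModuleCat.ofHom (Finsupp.lsingle j)
  let p (j : J) : ModuleCat.of R (J →₀ R) ⟶ ModuleCat.of R R := ModuleCat.ofHom (Finsupp.lapply j)
  obtain ⟨t, ht⟩ := hX (fun j => p j ≫ ι j) (fun y => ⟨y.support, fun t ht => by
    change ∑ j ∈ t, Finsupp.single j (y j) = y
    exact (Finsupp.sum_of_support_subset y ht (fun j a => Finsupp.single j a) (by simp)).symm.trans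
      y.sum_single⟩) x
  rw [ht]
  refine Finset.sum_eq_zero fun j _ => ?_
  rw [← Ext.mk₀_comp_mk₀, ← Ext.comp_assoc_of_third_deg_zero, h (x.comp _ _), Ext.zero_comp]

/-- Descending induction on the degree, starting from the known bound m. For a free cover of M, Extⁱ
vanishes on the free module by `eq_zero_of_regular` and Extⁱ⁺¹ vanishes on the kernel by induction,
so Extⁱ(X, M) = 0. -/
lemma ModuleCat.HasLocallyFiniteExt.hasProjectiveDimensionLT {X : ModuleCat.{u} R}
    (hX : X.HasLocallyFiniteExt) {m d : ℕ} [hm : HasProjectiveDimensionLT X m]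
    (h : ∀ i, d < i → ∀ x : Ext.{u} X (ModuleCat.of R R) i, x = 0) :
    HasProjectiveDimensionLT X (d + 1) := by
  suffices ∀ j, ∀ i, d < i → m ≤ i + j → ∀ (M : ModuleCat.{u} R) (x : Ext.{u} X M i), x = 0 by
    refine hasProjectiveDimensionLT_iff X (d + 1) |>.2 fun i hi Y x => this m i (by lia) (by lia) Y x
  intro j
  induction j with
  | zero => intro i _ hi M x; exact x.eq_zero_of_hasProjectiveDimensionLT m hi
  | succ j ih =>
    intro i hi hij M x
    let g : ModuleCat.of R (M →₀ R) ⟶ M := ModuleCat.ofHom (Finsupp.linearCombination R id)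
    have hg : Function.Surjective g.hom := Finsupp.linearCombination_id_surjective R M
    let S : ShortComplex (ModuleCat.{u} R) := ShortComplex.mk (ModuleCat.ofHom
      (LinearMap.ker g.hom).subtype) g (by ext x; exact x.2)
    have hS : S.ShortExact :=
      { exact := ModuleCat.shortComplex_exact S fun x =>
          ⟨fun hx => ⟨⟨x, hx⟩, rfl⟩, by rintro ⟨y, rfl⟩; exact y.2⟩
        mono_f := (ModuleCat.mono_iff_injective _).2 Subtype.val_injective
        epi_g := (ModuleCat.epi_iff_surjective _).2 hg }
    obtain ⟨y, hy⟩ := Ext.covariant_sequence_exact₃ X hS x rfl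
      (ih (i + 1) (by lia) (by lia) _ _)
    rw [← hy, hX.eq_zero_of_regular (h i hi) M y, Ext.zero_comp]

end LocallyFiniteExt

/-! ### Ext of bimodules as Ext of the trivial module -/

section TrivialExt

open Coalgebra HopfAlgebra ModuleCat

variable {k : Type u} [Field k] {H : Type u} [Ring H] [HopfAlgebra k H]
  {E : Type u} [Ring E] [Algebra k E] (e : EnvelopingAlgebra k H ≃ₐ[k] E)
  {D : ModuleCat.{u} E} (i : H ≃ₗ[k] D) (hD : ∀ a b x : H, i (a * x * b) = e (a ⊗ₜ op b) • i x)

/-- Extensions of bimodules out of `H` as extensions of modules out of the trivial module. -/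
def adjointExtEquiv (N : ModuleCat.{u} E) (n : ℕ) :
    Ext.{u} D N n ≃ₗ[k] Ext.{u} (leftTrivial k H) ((adjointFunctor e).obj N) n :=
  { Ext.precompIso (bimoduleTrivialIso e i hD) N n with
    map_smul' := fun c x => Ext.precompIso_smul (bimoduleTrivialIso e i hD) N n c x } ≪≫ₗ
    (bimoduleAdj e).extLinearEquiv k (leftTrivial k H) N n

lemma adjointExtEquiv_comp_mk₀ {N N' : ModuleCat.{u} E} {n : ℕ} (x : Ext.{u} D N n) (g : N ⟶ N') :
    adjointExtEquiv e i hD N' n (x.comp (Ext.mk₀ g) (add_zero n)) =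
      (adjointExtEquiv e i hD N n x).comp (Ext.mk₀ ((adjointFunctor e).map g)) (add_zero n) := by
  refine Eq.trans ?_ ((bimoduleAdj e).extAddEquiv_comp_mk₀
    (Ext.precompIso (bimoduleTrivialIso e i hD) N n x) g)
  refine congrArg ((bimoduleAdj e).extAddEquiv (leftTrivial k H) N' n) ?_
  exact (Ext.comp_assoc_of_third_deg_zero _ _ _ (zero_add n)).symm

/-- The homomorphism `counitRight`, transported to an algebra `E` isomorphic to `Hᵉ`. -/
def counitRight' : E →ₐ[k] H := (counitRight k H).comp e.symm.toAlgHom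

lemma counitRight'_apply (a : EnvelopingAlgebra k H) :
    counitRight' e (e a) = counitRight k H a := by
  simp [counitRight']

lemma counitRight'_adjointHom' (h : H) : counitRight' e (adjointHom' e h) = h := by
  rw [adjointHom'_apply, counitRight'_apply, counitRight_adjointHom]

/-- The functor from `H`-modules to `Hᵉ`-modules with trivial action on the right. -/
abbrev inflationFunctor : ModuleCat.{u} H ⥤ ModuleCat.{u} E := resFunctor (counitRight' e)

/-- The adjoint action on a module with trivial right action is the given one. -/
def inflationIso (M : ModuleCat.{u} H) : (adjointFunctor e).obj ((inflationFunctor e).obj M) ≅ M :=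
  ofRepIso (φ := (rep k (ofRep ((rep k M).comp (counitRight' e)))).comp (adjointHom' e))
    (ofRepEquiv ((rep k M).comp (counitRight' e))).symm (by
    intro a x
    obtain ⟨x, rfl⟩ := (ofRepEquiv ((rep k M).comp (counitRight' e))).surjective x
    rw [AlgHom.comp_apply, rep_apply, smul_ofRepEquiv, LinearEquiv.symm_apply_apply,
      LinearEquiv.symm_apply_apply, AlgHom.comp_apply, counitRight'_adjointHom', rep_apply])

/-- Extensions of bimodules of `H` by a module with trivial right action. -/
def inflationExtEquiv (M : ModuleCat.{u} H) (n : ℕ) :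
    Ext.{u} D ((inflationFunctor e).obj M) n ≃ₗ[k] Ext.{u} (leftTrivial k H) M n :=
  adjointExtEquiv e i hD ((inflationFunctor e).obj M) n ≪≫ₗ
    { Ext.postcompIso (leftTrivial k H) (inflationIso e M) n with
      map_smul' := fun c x => Ext.postcompIso_smul _ (inflationIso e M) n c x }

lemma inflationExtEquiv_comp_mk₀ {M N : ModuleCat.{u} H} {n : ℕ}
    (x : Ext.{u} D ((inflationFunctor e).obj M) n) (g : M ⟶ N) :
    inflationExtEquiv e i hD N n (x.comp (Ext.mk₀ ((inflationFunctor e).map g)) (add_zero n)) =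
      (inflationExtEquiv e i hD M n x).comp (Ext.mk₀ g) (add_zero n) := by
  change (adjointExtEquiv e i hD _ n (x.comp (Ext.mk₀ ((inflationFunctor e).map g)) _)).comp
    (Ext.mk₀ (inflationIso e N).hom) (add_zero n) =
    ((adjointExtEquiv e i hD _ n x).comp (Ext.mk₀ (inflationIso e M).hom) (add_zero n)).comp
      (Ext.mk₀ g) (add_zero n)
  rw [adjointExtEquiv_comp_mk₀, Ext.comp_assoc_of_third_deg_zero, Ext.comp_assoc_of_third_deg_zero,
    Ext.mk₀_comp_mk₀, Ext.mk₀_comp_mk₀]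
  rfl

include hD in
-- Inflation keeps underlying sets and maps, so a locally finite family on N is one on the inflated
-- bimodule, where the hypothesis on `D` applies.
lemma hasLocallyFiniteExt_leftTrivial (h : D.HasLocallyFiniteExt) :
    (leftTrivial k H).HasLocallyFiniteExt := by
  intro N J q hq n x
  obtain ⟨x, rfl⟩ := (inflationExtEquiv e i hD N n).surjective x
  obtain ⟨t, ht⟩ := h (fun j => (inflationFunctor e).map (q j)) hq x
  refine ⟨t, ?_⟩
  simp_rw [← inflationExtEquiv_comp_mk₀, ← map_sum]
  rw [← ht]

include hD in
lemma hasProjectiveDimensionLT_leftTrivial {m : ℕ} [HasProjectiveDimensionLT D m] :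
    HasProjectiveDimensionLT (leftTrivial k H) m :=
  hasProjectiveDimensionLT_iff _ m |>.2 fun n hn M x => by
    obtain ⟨x, rfl⟩ := (inflationExtEquiv e i hD M n).surjective x
    rw [x.eq_zero_of_hasProjectiveDimensionLT m hn, map_zero]

/-- Extensions of a representation as extensions of the trivial module. -/
def homExtEquiv {V : Type u} [AddCommGroup V] [Module k V] (θ : H →ₐ[k] Module.End k V)
    (N : ModuleCat.{u} H) (n : ℕ) :
    Ext.{u} (ofRep θ) N n ≃ₗ[k] Ext.{u} (leftTrivial k H) ((homFunctor θ).obj N) n :=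
  { Ext.precompIso (tensorTrivialIso θ) N n with
    map_smul' := fun c x => Ext.precompIso_smul (tensorTrivialIso θ) N n c x } ≪≫ₗ
    (tensorHomAdj θ).extLinearEquiv k (leftTrivial k H) N n

/-- Ext(M, N) ≅ Ext(k, Hom(M, N)), so no module has larger projective dimension than k. -/
lemma hasProjectiveDimensionLT_of_leftTrivial {m : ℕ}
    [hm : HasProjectiveDimensionLT (leftTrivial k H) m] (M : ModuleCat.{u} H) :
    HasProjectiveDimensionLT M m := by
  suffices HasProjectiveDimensionLT (ofRep (rep k M)) m from
    hasProjectiveDimensionLT_of_iso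
      (ofRepIso (φ := rep k M) (LinearEquiv.refl k M) fun _ _ => rfl) m
  refine hasProjectiveDimensionLT_iff _ m |>.2 fun n hn N x => ?_
  apply (homExtEquiv (rep k M) N n).injective
  rw [map_zero]
  exact Ext.eq_zero_of_hasProjectiveDimensionLT _ m hn

end TrivialExt

/-! ### The adjoint module of Hᵉ and its right multiplications -/

section RegularBimodule

open Coalgebra HopfAlgebra ModuleCat

section

variable {k : Type u} [Field k] {A : Type u} [Ring A] [Algebra k A]

/-- Right multiplication on the regular module. -/
def regMulRight (a : A) : regModule A ⟶ regModule A :=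
  ModuleCat.ofHom (LinearMap.toSpanSingleton A A a)

lemma regMulRight_apply (a x : A) :
    (regMulRight a).hom (regEquiv k A x) = regEquiv k A (x * a) := rfl

lemma regMulRight_comp {A : Type u} [Ring A] (a b : A) :
    regMulRight a ≫ regMulRight b = regMulRight (a * b) :=
  ModuleCat.hom_ext (LinearMap.ext fun x : A => mul_assoc x a b)

lemma regMulRight_add {A : Type u} [Ring A] (a b : A) :
    regMulRight (a + b) = regMulRight a + regMulRight b :=
  ModuleCat.hom_ext (LinearMap.ext fun x : A => mul_add x a b)

lemma regMulRight_one {A : Type u} [Ring A] : regMulRight (1 : A) = 𝟙 _ :=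
  ModuleCat.hom_ext (LinearMap.ext fun x : A => mul_one x)

lemma regMulRight_smul (c : k) (a : A) : regMulRight (c • a) = c • regMulRight a :=
  regModule_hom_ext k (by
    rw [smul_hom_apply, regMulRight_apply, regMulRight_apply, mul_smul_comm, map_smul])

end

variable {k : Type u} [Field k] {H : Type u} [Ring H] [HopfAlgebra k H]

lemma diagModule_hom_ext {V : Type u} [AddCommGroup V] [Module k V] {θ : H →ₐ[k] Module.End k V}
    {M : ModuleCat.{u} H} {f g : diagModule θ ⟶ M} (h : ∀ v, diagIncl θ v ≫ f = diagIncl θ v ≫ g) :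
    f = g := by
  ext x
  obtain ⟨x, rfl⟩ := (diagEquiv θ).surjective x
  induction x with
  | zero => simp
  | add x y hx hy => simp only [map_add, hx, hy]
  | tmul a v => exact congr(($(h v)).hom (regEquiv k H a))

variable {E : Type u} [Ring E] [Algebra k E] (e : EnvelopingAlgebra k H ≃ₐ[k] E)

variable (k H) in
/-- The representation of `H` on `Hᵒᵖ` by left multiplication through the antipode. -/
def antipodeRep : H →ₐ[k] Module.End k Hᵐᵒᵖ :=
  (Algebra.lmul k Hᵐᵒᵖ).comp (antipodeAlgHomOp k H)

lemma tensorRep_antipodeRep (h : H) (x : H ⊗[k] Hᵐᵒᵖ) :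
    tensorRep (Algebra.lmul k H) (antipodeRep k H) h x = adjointHom k H h * x := by
  induction x with
  | zero => simp
  | add x y hx hy => simp only [map_add, mul_add, hx, hy]
  | tmul a b =>
    let r := Repr.arbitrary k h
    rw [tensorRep_apply _ _ r, adjointHom_apply k r, Finset.sum_mul]
    simp_rw [Algebra.TensorProduct.tmul_mul_tmul]
    rfl

/-- The adjoint action on `Hᵉ` as a diagonal action. -/
def adjointRegIso :
    diagModule (antipodeRep k H) ≅ ofRep ((rep k (regModule E)).comp (adjointHom' e)) :=
  ofRepIso (e.toLinearEquiv ≪≫ₗ regEquiv k E ≪≫ₗ ofRepEquiv _) (by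
    intro a x
    simp only [LinearEquiv.trans_apply, AlgEquiv.toLinearEquiv_apply]
    rw [smul_ofRepEquiv, tensorRep_antipodeRep, map_mul]
    rfl)

lemma adjointRegIso_hom_apply (x : H ⊗[k] Hᵐᵒᵖ) :
    (adjointRegIso e).hom.hom (ofRepEquiv _ x) = ofRepEquiv _ (regEquiv k E (e x)) := rfl

/-- The morphism `a ↦ a₍₁₎ ⊗ b S(a₍₂₎)` from `H` to `Hᵉ`. -/
def adjointIncl (b : H) :
    regModule H ⟶ ofRep ((rep k (regModule E)).comp (adjointHom' e)) :=
  diagIncl (antipodeRep k H) (op b) ≫ (adjointRegIso e).hom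

lemma adjointIncl_apply_one (b : H) :
    (adjointIncl e b).hom (regEquiv k H 1) = ofRepEquiv _ (regEquiv k E (e (1 ⊗ₜ op b))) := by
  rw [adjointIncl, ModuleCat.hom_comp, LinearMap.comp_apply, diagIncl_apply, diagEquiv,
    LinearEquiv.trans_apply, adjointRegIso_hom_apply, untwist_tmul, map_one, Module.End.one_apply]

/-- The morphism from `Hᵉ` to `H` left inverse to `adjointIncl` up to `f`. -/
def adjointProj (f : H →ₗ[k] k) :
    ofRep ((rep k (regModule E)).comp (adjointHom' e)) ⟶ regModule H :=
  (adjointRegIso e).inv ≫ diagProj (antipodeRep k H) (f ∘ₗ (opLinearEquiv k).symm.toLinearMap)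

lemma adjointIncl_comp_adjointProj (b : H) (f : H →ₗ[k] k) :
    adjointIncl e b ≫ adjointProj e f = f b • 𝟙 _ := by
  rw [adjointIncl, adjointProj, Category.assoc, Iso.hom_inv_id_assoc, diagIncl_comp_diagProj]
  rfl

lemma adjointIncl_add (b c : H) : adjointIncl e (b + c) = adjointIncl e b + adjointIncl e c := by
  rw [adjointIncl, MulOpposite.op_add, diagIncl_add, Preadditive.add_comp]; rfl

lemma adjointIncl_smul (c : k) (b : H) : adjointIncl e (c • b) = c • adjointIncl e b := by
  rw [adjointIncl, op_smul, diagIncl_smul, Linear.smul_comp]; rfl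

variable (k) in
lemma adjointReg_hom_ext {M : ModuleCat.{u} H}
    {f g : ofRep ((rep k (regModule E)).comp (adjointHom' e)) ⟶ M}
    (h : ∀ b, adjointIncl e b ≫ f = adjointIncl e b ≫ g) : f = g := by
  rw [← cancel_epi (adjointRegIso e).hom]
  refine diagModule_hom_ext fun v => ?_
  simpa only [adjointIncl, Category.assoc, op_unop] using h v.unop

lemma exists_sum_adjointProj_comp_adjointIncl {ι : Type*} (b : Module.Basis ι k H)
    (x : ofRep ((rep k (regModule E)).comp (adjointHom' e))) :
    ∃ s : Finset ι, ∀ t, s ⊆ t →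
      ∑ j ∈ t, (adjointProj e (b.coord j) ≫ adjointIncl e (b j)).hom x = x := by
  obtain ⟨x, rfl⟩ := (adjointRegIso e).toLinearEquiv.surjective x
  obtain ⟨s, hs⟩ := exists_sum_diagProj_comp_diagIncl (antipodeRep k H)
    (b.map (opLinearEquiv k)) x
  refine ⟨s, fun t ht => ?_⟩
  have := congr((adjointRegIso e).hom.hom $(hs t ht))
  rw [map_sum] at this
  refine Eq.trans (Finset.sum_congr rfl fun j _ => ?_) this
  have h : (adjointRegIso e).hom ≫ adjointProj e (b.coord j) ≫ adjointIncl e (b j) =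
    (diagProj (antipodeRep k H) ((b.map (opLinearEquiv k)).coord j) ≫
      diagIncl (antipodeRep k H) ((b.map (opLinearEquiv k)) j)) ≫ (adjointRegIso e).hom := by
    rw [adjointProj, adjointIncl, Category.assoc, Iso.hom_inv_id_assoc, Category.assoc]
    rfl
  exact congr(($h).hom x)

/-- Right multiplication on `Hᵉ`, as a morphism for the adjoint action. -/
abbrev adjointMulRight (r : E) :
    ofRep ((rep k (regModule E)).comp (adjointHom' e)) ⟶
      ofRep ((rep k (regModule E)).comp (adjointHom' e)) :=
  (adjointFunctor e).map (regMulRight r)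

lemma adjointMulRight_apply (r x : E) :
    (adjointMulRight e r).hom (ofRepEquiv _ (regEquiv k E x)) =
      ofRepEquiv _ (regEquiv k E (x * r)) := rfl

lemma adjointIncl_comp_mulRight_one_tmul (b h : H) :
    adjointIncl e b ≫ adjointMulRight e (e (1 ⊗ₜ op h)) = adjointIncl e (h * b) := by
  refine regModule_hom_ext k ?_
  rw [ModuleCat.hom_comp, LinearMap.comp_apply, adjointIncl_apply_one, adjointIncl_apply_one,
    adjointMulRight_apply, ← map_mul, Algebra.TensorProduct.tmul_mul_tmul, one_mul, op_mul]

/-- Multiplicativity of ε: on the copy of H indexed by b both sides are ε(h b) = ε(h) ε(b). -/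
lemma adjointMulRight_comp_adjointProj_counit (h : H) :
    adjointMulRight e (e (1 ⊗ₜ op h)) ≫ adjointProj e (counit (R := k)) =
      counit (R := k) h • adjointProj e (counit (R := k)) := by
  refine adjointReg_hom_ext k e fun b => ?_
  rw [← Category.assoc, adjointIncl_comp_mulRight_one_tmul, Linear.comp_smul,
    adjointIncl_comp_adjointProj, adjointIncl_comp_adjointProj, Bialgebra.counit_mul, mul_smul]

/-- The generator 1 ⊗ b goes to x ⊗ y b, which the inverse of `untwist` rewrites as the sum of x₁
acting on 1 ⊗ y b S²(x₂). One antipode comes from the adjoint action and one from untwisting; this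
is the S² in the twist μ. -/
lemma adjointIncl_comp_mulRight {ι : Type*} {x : H} (r : Repr k x ι) (b y : H) :
    adjointIncl e b ≫ adjointMulRight e (e (x ⊗ₜ op y)) =
      ∑ j ∈ r.index, regMulRight (r.left j) ≫
        adjointIncl e (y * b * antipode k (antipode k (r.right j))) := by
  refine regModule_hom_ext k ?_
  have key := congr(ofRepEquiv ((rep k (regModule E)).comp (adjointHom' e))
    (regEquiv k E (e (untwist (antipodeRep k H)
      $(untwist_symm_tmul (antipodeRep k H) r (op (y * b)))))))
  rw [LinearEquiv.apply_symm_apply] at key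
  rw [ModuleCat.hom_comp, LinearMap.comp_apply, adjointIncl_apply_one, adjointMulRight_apply,
    ← map_mul, Algebra.TensorProduct.tmul_mul_tmul, one_mul, ← op_mul, key, map_sum, map_sum,
    map_sum, map_sum, ModuleCat.hom_sum, LinearMap.sum_apply]
  refine Finset.sum_congr rfl fun j _ => ?_
  rw [ModuleCat.hom_comp, LinearMap.comp_apply, regMulRight_apply, one_mul]
  rfl

end RegularBimodule

/-! ### Winding automorphisms -/

section Winding

open Coalgebra HopfAlgebra

variable {k : Type u} [Field k] {H : Type u} [Ring H] [HopfAlgebra k H]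

/-- The map `h ↦ ξ(h₍₁₎) h₍₂₎`. -/
def winding (ξ : H →ₗ[k] k) : H →ₗ[k] H :=
  (TensorProduct.lid k H).toLinearMap ∘ₗ ξ.rTensor H ∘ₗ comul

lemma winding_apply (ξ : H →ₗ[k] k) {ι : Type*} {h : H} (r : Repr k h ι) :
    winding ξ h = ∑ i ∈ r.index, ξ (r.left i) • r.right i := by
  simp [winding, ← r.eq]

/-- By coassociativity windings compose by convolution: the composite is a ↦ ξ'(a₁) ξ(a₂) a₃. A
character is convolution invertible, with inverse ξ ∘ S, so its winding is bijective. -/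
lemma winding_winding (ξ ξ' : H →ₗ[k] k)
    (h : ∀ (a : H) (r : Repr k a (H × H)),
      ∑ i ∈ r.index, ξ' (r.left i) * ξ (r.right i) = counit a) (a : H) :
    winding ξ (winding ξ' a) = a := by
  let r := Repr.arbitrary k a
  let r₁ := fun i => Repr.arbitrary k (r.left i)
  let r₂ := fun i => Repr.arbitrary k (r.right i)
  have key := congr(TensorProduct.lift (LinearMap.lsmul k H ∘ₗ ξ')
    ((TensorProduct.lift (LinearMap.lsmul k H ∘ₗ ξ)).lTensor H
      $(sum_tmul_tmul_eq r r₁ r₂)))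
  simp only [map_sum, LinearMap.lTensor_tmul, TensorProduct.lift.tmul, LinearMap.comp_apply] at key
  rw [winding_apply ξ' r, map_sum]
  simp_rw [map_smul, fun i => winding_apply ξ (r₂ i), Finset.smul_sum]
  refine Eq.trans key.symm ?_
  refine Eq.trans (Finset.sum_congr rfl fun i _ => ?_) (sum_counit_smul r)
  rw [← h _ (r₁ i), Finset.sum_smul]
  exact Finset.sum_congr rfl fun j _ => smul_smul _ _ _

lemma winding_bijective (ξ : H →ₐ[k] k) : Function.Bijective (winding ξ.toLinearMap) := by
  refine Function.bijective_iff_has_inverse.2 ⟨winding (ξ.toLinearMap ∘ₗ antipode k),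
    winding_winding _ _ fun a r => ?_, winding_winding _ _ fun a r => ?_⟩
  · have := congr(ξ $(sum_mul_antipode_eq_algebraMap_counit r))
    simpa using this
  · have := congr(ξ $(sum_antipode_mul_eq_algebraMap_counit r))
    simpa using this

lemma winding_mul (ξ : H →ₐ[k] k) (a b : H) :
    winding ξ.toLinearMap (a * b) = winding ξ.toLinearMap a * winding ξ.toLinearMap b := by
  let f : H →ₐ[k] H := ((Algebra.TensorProduct.lid k H).toAlgHom.comp
    (Algebra.TensorProduct.map ξ (AlgHom.id k H))).comp (Bialgebra.comulAlgHom k H)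
  exact map_mul f a b

lemma winding_one (ξ : H →ₐ[k] k) : winding ξ.toLinearMap 1 = 1 := by
  let f : H →ₐ[k] H := ((Algebra.TensorProduct.lid k H).toAlgHom.comp
    (Algebra.TensorProduct.map ξ (AlgHom.id k H))).comp (Bialgebra.comulAlgHom k H)
  exact map_one f

/-- The automorphism `h ↦ ξ(h₍₁₎) S²(h₍₂₎)`. -/
def antipodeSqWinding (hS : Function.Bijective (antipode k : H →ₗ[k] H)) (ξ : H →ₐ[k] k) :
    H ≃ₐ[k] H :=
  AlgEquiv.ofBijective (AlgHom.ofLinearMap (antipode k ∘ₗ antipode k ∘ₗ winding ξ.toLinearMap)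
    (by simp [winding_one]) (by simp [winding_mul, antipode_mul_antidistrib]))
    (hS.comp (hS.comp (winding_bijective ξ)))

lemma antipodeSqWinding_apply (hS : Function.Bijective (antipode k : H →ₗ[k] H)) (ξ : H →ₐ[k] k)
    {ι : Type*} {h : H} (r : Repr k h ι) :
    antipodeSqWinding hS ξ h =
      ∑ i ∈ r.index, ξ (r.left i) • antipode k (antipode k (r.right i)) := by
  change antipode k (antipode k (winding ξ.toLinearMap h)) = _
  rw [winding_apply _ r, map_sum, map_sum]
  simp_rw [map_smul]
  rfl

end Winding

/-! ### Equivalence of the bimodule condition with the left condition -/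

section CalabiYau

open Coalgebra HopfAlgebra ModuleCat

section

variable {k : Type u} [Field k] {A : Type u} [Ring A] [Algebra k A]

variable (k) in
/-- Composition of a fixed extension with morphisms, as a linear map. -/
def ModuleCat.extPush {X Y : ModuleCat.{u} A} (Z : ModuleCat.{u} A) {n : ℕ} (x : Ext.{u} X Y n) :
    (Y ⟶ Z) →ₗ[k] Ext.{u} X Z n where
  toFun f := x.comp (Ext.mk₀ f) (add_zero n)
  map_add' f g := by rw [Ext.mk₀_add, Ext.comp_add]
  map_smul' c f := by rw [Ext.mk₀_smul, Ext.comp_smul]; rfl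

lemma ModuleCat.extPush_apply {X Y Z : ModuleCat.{u} A} {n : ℕ} (x : Ext.{u} X Y n) (f : Y ⟶ Z) :
    extPush k Z x f = x.comp (Ext.mk₀ f) (add_zero n) := rfl

lemma ModuleCat.extPush_comp {X Y Z W : ModuleCat.{u} A} {n : ℕ} (x : Ext.{u} X Y n) (f : Y ⟶ Z)
    (g : Z ⟶ W) : extPush k W x (f ≫ g) = extPush k W (extPush k Z x f) g := by
  simp only [extPush_apply, Ext.comp_assoc_of_third_deg_zero, Ext.mk₀_comp_mk₀]

lemma ModuleCat.extPush_smul {X Y Z : ModuleCat.{u} A} {n : ℕ} (c : k) (x : Ext.{u} X Y n)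
    (f : Y ⟶ Z) : extPush k Z (c • x) f = c • extPush k Z x f := by
  simp only [extPush_apply, Ext.smul_comp]

lemma ModuleCat.extPush_zero {X Y Z : ModuleCat.{u} A} {n : ℕ}
    (f : Y ⟶ Z) : extPush k Z (0 : Ext.{u} X Y n) f = 0 := by
  simp only [extPush_apply, Ext.zero_comp]

lemma ModuleCat.extPush_id {X Y : ModuleCat.{u} A} {n : ℕ} (x : Ext.{u} X Y n) :
    extPush k Y x (𝟙 Y) = x := by
  simp only [extPush_apply, Ext.comp_mk₀_id]

end

variable {k : Type u} [Field k] {H : Type u} [Ring H] [HopfAlgebra k H]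
  {E : Type u} [Ring E] [Algebra k E] (e : EnvelopingAlgebra k H ≃ₐ[k] E)

section

variable {X : ModuleCat.{u} H} {n : ℕ}

lemma extPush_adjointIncl_proj (x : Ext.{u} X (regModule H) n) (b : H) (f : H →ₗ[k] k) :
    extPush k _ (extPush k _ x (adjointIncl e b)) (adjointProj e f) = f b • x := by
  rw [← extPush_comp, adjointIncl_comp_adjointProj, map_smul, extPush_id]

variable (k) in
lemma exists_sum_extPush_adjoint (hX : X.HasLocallyFiniteExt) {J : Type u} (b : Module.Basis J k H)
    (x : Ext.{u} X (ofRep ((rep k (regModule E)).comp (adjointHom' e))) n) :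
    ∃ t : Finset J, x = ∑ j ∈ t,
      extPush k _ (extPush k _ x (adjointProj e (b.coord j))) (adjointIncl e (b j)) := by
  obtain ⟨t, ht⟩ := hX _ (exists_sum_adjointProj_comp_adjointIncl e b) x
  refine ⟨t, ht.trans (Finset.sum_congr rfl fun j _ => ?_)⟩
  rw [← extPush_comp]; rfl

/-- Every class is a finite sum of classes pushed through Ext(X, H). -/
lemma subsingleton_ext_adjoint (hX : X.HasLocallyFiniteExt)
    (h : Subsingleton (Ext.{u} X (regModule H) n)) :
    Subsingleton (Ext.{u} X (ofRep ((rep k (regModule E)).comp (adjointHom' e))) n) := by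
  refine subsingleton_of_forall_eq 0 fun x => ?_
  obtain ⟨t, ht⟩ := exists_sum_extPush_adjoint k e hX (Module.Basis.ofVectorSpace k H) x
  rw [ht]
  refine Finset.sum_eq_zero fun j _ => ?_
  rw [Subsingleton.elim (extPush k (regModule H) x _) 0, extPush_zero]

/-- Since ε(1) = 1, H is a retract of the adjoint module by `adjointIncl e 1` and `adjointProj e
counit`. -/
lemma subsingleton_ext_regModule
    (h : Subsingleton (Ext.{u} X (ofRep ((rep k (regModule E)).comp (adjointHom' e))) n)) :
    Subsingleton (Ext.{u} X (regModule H) n) := by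
  refine subsingleton_of_forall_eq 0 fun x => ?_
  rw [← one_smul k x, ← Bialgebra.counit_one (R := k) (A := H), ← extPush_adjointIncl_proj e x 1,
    Subsingleton.elim (extPush k _ x _) 0, extPush_zero]

end

variable {D : ModuleCat.{u} E} (i : H ≃ₗ[k] D) (hD : ∀ a b x : H, i (a * x * b) = e (a ⊗ₜ op b) • i x)
/-- The isomorphism `adjointExtEquiv` for the regular bimodule. -/
def adjointRegExtEquiv (n : ℕ) : Ext.{u} D (regModule E) n ≃ₗ[k]
    Ext.{u} (leftTrivial k H) (ofRep ((rep k (regModule E)).comp (adjointHom' e))) n :=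
  adjointExtEquiv e i hD (regModule E) n

lemma adjointRegExtEquiv_extPush {n : ℕ} (x : Ext.{u} D (regModule E) n) (r : E) :
    adjointRegExtEquiv e i hD n (extPush k _ x (regMulRight r)) =
      extPush k _ (adjointRegExtEquiv e i hD n x) (adjointMulRight e r) :=
  adjointExtEquiv_comp_mk₀ e i hD x (regMulRight r)

include hD

lemma ext_leftTrivial_of_ext_regModule (hX : (leftTrivial k H).HasLocallyFiniteExt) {d : ℕ}
    (h0 : ∀ j, j ≠ d → Subsingleton (Ext.{u} D (regModule E) j))
    {μ : H → H} (hμ : μ 1 = 1) (φ : Ext.{u} D (regModule E) d ≃+ H)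
    (hφ : ∀ (a b : H) (x : Ext.{u} D (regModule E) d),
      φ (extPush k _ x (regMulRight (e (a ⊗ₜ op b)))) = b * φ x * μ a) :
    (∀ j, j ≠ d → Subsingleton (Ext.{u} (leftTrivial k H) (regModule H) j)) ∧
      Module.finrank k (Ext.{u} (leftTrivial k H) (regModule H) d) = 1 := by
  refine ⟨fun j hj => subsingleton_ext_regModule e ?_, ?_⟩
  · have := h0 j hj
    exact (adjointRegExtEquiv e i hD j).symm.injective.subsingleton
  have hH : Nontrivial H :=
    ⟨1, 0, fun h => one_ne_zero (α := k) (by simpa using congr(counit (R := k) $h))⟩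
  -- A generator of the bimodule. Its contraction `v` with ε spans Extᵈ(k, H), because right
  -- multiplication by 1 ⊗ h becomes the scalar ε(h).
  let e₁ := φ.symm 1
  let v := extPush k _ (adjointRegExtEquiv e i hD d e₁)
    (adjointProj e (counit (R := k)))
  have hv (w : Ext.{u} (leftTrivial k H) (regModule H) d) : ∃ c : k, c • v = w := by
    obtain ⟨x, hx⟩ := (adjointRegExtEquiv e i hD d).surjective
      (extPush k _ w (adjointIncl e 1))
    refine ⟨counit (φ x), ?_⟩
    have hx' : x = extPush k _ e₁ (regMulRight (e (1 ⊗ₜ op (φ x)))) := φ.injective (by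
      rw [hφ, hμ, mul_one, AddEquiv.apply_symm_apply, mul_one])
    have := extPush_adjointIncl_proj e w 1 (counit (R := k))
    rw [Bialgebra.counit_one, one_smul] at this
    rw [← this, ← hx]
    conv_rhs => rw [hx', adjointRegExtEquiv_extPush, ← extPush_comp,
      adjointMulRight_comp_adjointProj_counit, map_smul]
  refine finrank_eq_one_iff'.2 ⟨v, fun h => ?_, hv⟩
  -- If `v` were zero, Extᵈ(k, H) would vanish, hence by local finiteness also the bimodule, which
  -- is a copy of H.
  have hs : Subsingleton (Ext.{u} (leftTrivial k H) (regModule H) d) :=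
    subsingleton_of_forall_eq 0 fun w => by
      obtain ⟨c, rfl⟩ := hv w
      rw [h, smul_zero]
  have := subsingleton_ext_adjoint e hX hs
  have := (adjointRegExtEquiv e i hD d).injective.subsingleton
  exact not_subsingleton H φ.symm.injective.subsingleton

lemma ext_regModule_of_ext_leftTrivial (hS : Function.Bijective (antipode k : H →ₗ[k] H))
    (hX : (leftTrivial k H).HasLocallyFiniteExt) {d : ℕ}
    (h0 : ∀ j, j ≠ d → Subsingleton (Ext.{u} (leftTrivial k H) (regModule H) j))
    (h1 : Module.finrank k (Ext.{u} (leftTrivial k H) (regModule H) d) = 1) :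
    (∀ j, j ≠ d → Subsingleton (Ext.{u} D (regModule E) j)) ∧
      ∃ (μ : H ≃ₐ[k] H) (φ : Ext.{u} D (regModule E) d ≃+ H),
        ∀ (a b : H) (x : Ext.{u} D (regModule E) d),
          φ (extPush k _ x (regMulRight (e (a ⊗ₜ op b)))) = b * φ x * μ a := by
  refine ⟨fun j hj => ?_, ?_⟩
  · have := subsingleton_ext_adjoint e hX (h0 j hj)
    exact (adjointRegExtEquiv e i hD j).injective.subsingleton
  obtain ⟨v, hv0, hv⟩ := finrank_eq_one_iff'.1 h1
  -- Right multiplication by `a` acts on the line spanned by `v`; `ξ₀ a` is its scalar.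
  choose ξ₀ hξ₀ using fun a : H => hv (extPush k _ v (regMulRight a))
  have hinj {c c' : k} (h : c • v = c' • v) : c = c' := smul_left_injective k hv0 h
  let ξ : H →ₐ[k] k := AlgHom.ofLinearMap
    { toFun := ξ₀
      map_add' := fun a b => hinj (by
        rw [add_smul, hξ₀, hξ₀, hξ₀, regMulRight_add, map_add])
      map_smul' := fun c a => hinj (by
        rw [smul_assoc, RingHom.id_apply, hξ₀, hξ₀, regMulRight_smul, map_smul]) }
    (hinj (by
      rw [one_smul]
      exact (hξ₀ 1).trans (by rw [regMulRight_one, extPush_id])))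
    (fun a b => hinj (by
      refine (hξ₀ _).trans ?_
      rw [← regMulRight_comp, extPush_comp, ← hξ₀ a, extPush_smul, ← hξ₀ b, smul_smul]; rfl))
  have hξ (a : H) : extPush k _ v (regMulRight a) = ξ a • v := (hξ₀ a).symm
  -- The element `h` plays the part of v ⊗ h in Ext(k, H) ⊗ H.
  let ψ : H →+ Ext.{u} (leftTrivial k H)
      (ofRep ((rep k (regModule E)).comp (adjointHom' e))) d :=
    { toFun := fun h => extPush k _ v (adjointIncl e h)
      map_zero' := by rw [← zero_smul k (0 : H), adjointIncl_smul, zero_smul, map_zero]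
      map_add' := fun a b => by rw [adjointIncl_add, map_add] }
  have hψs (c : k) (h : H) : ψ (c • h) = c • ψ h := by
    change extPush k _ v _ = c • extPush k _ v _
    rw [adjointIncl_smul, map_smul]
  have hψ : Function.Bijective ψ := by
    constructor
    -- Contracting ψ(h) with a functional f returns f(h) v, and functionals separate the points of
    -- H.
    · refine (injective_iff_map_eq_zero ψ).2 fun h hh => ?_
      refine (Module.forall_dual_apply_eq_zero_iff k h).1 fun f => ?_
      have := extPush_adjointIncl_proj e v h f
      rw [show extPush k _ v (adjointIncl e h) = 0 from hh, extPush_zero] at this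
      exact (smul_eq_zero.1 this.symm).resolve_right hv0
    · intro x
      obtain ⟨t, ht⟩ := exists_sum_extPush_adjoint k e hX (Module.Basis.ofVectorSpace k H) x
      choose c hc using fun j => hv (extPush k _ x
        (adjointProj e ((Module.Basis.ofVectorSpace k H).coord j)))
      refine ⟨∑ j ∈ t, c j • Module.Basis.ofVectorSpace k H j, ?_⟩
      rw [ht, map_sum]
      refine Finset.sum_congr rfl fun j _ => ?_
      rw [hψs, ← hc, extPush_smul]; rfl
  let Ψ := AddEquiv.ofBijective ψ hψ
  let φ : Ext.{u} D (regModule E) d ≃+ H :=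
    (adjointRegExtEquiv e i hD d).toAddEquiv.trans Ψ.symm
  refine ⟨antipodeSqWinding hS ξ, φ, fun a b x => ?_⟩
  obtain ⟨h, rfl⟩ := φ.symm.surjective x
  rw [AddEquiv.apply_symm_apply]
  refine Ψ.injective ((Ψ.apply_symm_apply _).trans ?_)
  have hh : adjointRegExtEquiv e i hD d (φ.symm h) = extPush k _ v (adjointIncl e h) :=
    (adjointRegExtEquiv e i hD d).apply_symm_apply _
  let r := Repr.arbitrary k a
  refine (adjointRegExtEquiv_extPush e i hD _ _).trans ?_
  -- Moving a past the inclusion puts a₁ next to `v`, where it acts by ξ, and leaves b h S²(a₂) in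
  -- the index.
  rw [hh, ← extPush_comp, adjointIncl_comp_mulRight e r, map_sum, antipodeSqWinding_apply hS ξ r,
    Finset.mul_sum, map_sum]
  refine Finset.sum_congr rfl fun j _ => ?_
  rw [extPush_comp, hξ, extPush_smul, mul_smul_comm]
  exact (hψs _ _).symm

end CalabiYau

/-! ### Global and injective dimension from a nonzero Ext -/

section Dimensions

variable {R : Type u} [Ring R]

lemma globalDimension_eq {d : ℕ} (h : ∀ M : ModuleCat.{u} R, HasProjectiveDimensionLT M (d + 1))
    {X Y : ModuleCat.{u} R} {x : Ext.{u} X Y d} (hx : x ≠ 0) : globalDimension R = d := by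
  refine le_antisymm (iSup_le fun M => (projectiveDimension_le_iff M d).2 (h M)) ?_
  refine le_trans ((projectiveDimension_ge_iff X d).2 fun hX => hx ?_) (le_iSup _ X)
  exact x.eq_zero_of_hasProjectiveDimensionLT d le_rfl

lemma ModuleCat.injectiveDimension_eq {d : ℕ}
    (h : ∀ M : ModuleCat.{u} R, HasProjectiveDimensionLT M (d + 1))
    {X Y : ModuleCat.{u} R} {x : Ext.{u} X Y d} (hx : x ≠ 0) : injectiveDimension Y = d := by
  refine le_antisymm ((injectiveDimension_le_iff Y d).2 ?_)
    ((injectiveDimension_ge_iff Y d).2 fun hY => hx (x.eq_zero_of_hasInjectiveDimensionLT d le_rfl))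
  refine hasInjectiveDimensionLT_iff Y (d + 1) |>.2 fun i hi M y => ?_
  have := h M
  exact y.eq_zero_of_hasProjectiveDimensionLT (d + 1) hi

lemma ModuleCat.hasProjectiveDimensionLT_of_resolution {X : ModuleCat.{u} R}
    (P : ProjectiveResolution X) {m : ℕ} (hm : ∀ i, m < i → Limits.IsZero (P.complex.X i)) :
    HasProjectiveDimensionLT X (m + 1) :=
  hasProjectiveDimensionLT_iff X (m + 1) |>.2 fun i hi Y e => by
    obtain ⟨f, hf, rfl⟩ := P.extMk_surjective e (i + 1) rfl
    obtain rfl := (hm i hi).eq_of_src f 0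
    exact P.extMk_zero (i + 1) rfl

end Dimensions

/-! ### Passage to right modules by the antipode -/

section RightModules

open Coalgebra HopfAlgebra ModuleCat

section

variable {k : Type u} [Field k] {A B : Type u} [Ring A] [Ring B] [Algebra k A] [Algebra k B]

/-- Extensions are unchanged under restriction along an isomorphism. -/
def resExtEquiv (f : A ≃ₐ[k] B) (X : ModuleCat.{u} A) (Y : ModuleCat.{u} B) (n : ℕ) :
    Ext.{u} ((resFunctor f.symm.toAlgHom).obj X) Y n ≃ₗ[k]
      Ext.{u} X ((resFunctor f.toAlgHom).obj Y) n :=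
  (resAdj f).extLinearEquiv k X Y n

/-- Restriction along an isomorphism and its inverse is the identity. -/
def resSymmIso (f : A ≃ₐ[k] B) (M : ModuleCat.{u} B) :
    (resFunctor f.symm.toAlgHom).obj ((resFunctor f.toAlgHom).obj M) ≅ M :=
  ofRepIso (φ := (rep k (ofRep ((rep k M).comp f.toAlgHom))).comp f.symm.toAlgHom)
    (ofRepEquiv ((rep k M).comp f.toAlgHom)).symm (by
    intro b x
    obtain ⟨x, rfl⟩ := (ofRepEquiv ((rep k M).comp f.toAlgHom)).surjective x
    rw [AlgHom.comp_apply, rep_apply, smul_ofRepEquiv, LinearEquiv.symm_apply_apply,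
      LinearEquiv.symm_apply_apply]
    simp [rep_apply])

lemma hasProjectiveDimensionLT_of_algEquiv (f : A ≃ₐ[k] B) {d : ℕ}
    (h : ∀ M : ModuleCat.{u} A, HasProjectiveDimensionLT M d) (M : ModuleCat.{u} B) :
    HasProjectiveDimensionLT M d := by
  suffices HasProjectiveDimensionLT
      ((resFunctor f.symm.toAlgHom).obj ((resFunctor f.toAlgHom).obj M)) d from
    hasProjectiveDimensionLT_of_iso (resSymmIso f M) d
  refine hasProjectiveDimensionLT_iff _ d |>.2 fun n hn N x => ?_
  apply (resExtEquiv f _ N n).injective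
  rw [map_zero]
  have := h ((resFunctor f.toAlgHom).obj M)
  exact Ext.eq_zero_of_hasProjectiveDimensionLT _ d hn

end

variable {k : Type u} [Field k] {H : Type u} [Ring H] [HopfAlgebra k H]

/-- The antipode as an isomorphism from `H` to `Hᵒᵖ`. -/
def antipodeEquiv (hS : Function.Bijective (antipode k : H →ₗ[k] H)) : H ≃ₐ[k] Hᵐᵒᵖ :=
  AlgEquiv.ofBijective (antipodeAlgHomOp k H) (opEquiv.bijective.comp hS)

lemma antipodeEquiv_apply (hS : Function.Bijective (antipode k : H →ₗ[k] H)) (h : H) :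
    antipodeEquiv hS h = op (antipode k h) := rfl

variable (H) in
/-- The regular right module. -/
def rightRegModule : ModuleCat.{u} Hᵐᵒᵖ := ModuleCat.of Hᵐᵒᵖ H

variable (k H) in
/-- The underlying vector space of the regular right module. -/
def rightRegEquiv : H ≃ₗ[k] rightRegModule H where
  toFun x := x
  invFun x := x
  map_add' _ _ := rfl
  map_smul' c x := (Algebra.smul_def c x).trans (Algebra.commutes c x)
  left_inv _ := rfl
  right_inv _ := rfl

/-- The antipode turns the trivial left module into the trivial right module. -/
def resLeftTrivialIso (hS : Function.Bijective (antipode k : H →ₗ[k] H)) :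
    (resFunctor (antipodeEquiv hS).symm.toAlgHom).obj (leftTrivial k H) ≅ rightTrivial k H :=
  ofRepIso (φ := (rep k (leftTrivial k H)).comp (antipodeEquiv hS).symm.toAlgHom)
    ((leftTrivialEquiv k H).symm ≪≫ₗ rightTrivialEquiv k H) (by
    intro a x
    obtain ⟨a, rfl⟩ := (antipodeEquiv hS).surjective a
    obtain ⟨x, rfl⟩ := (leftTrivialEquiv k H).surjective x
    have : ((rep k (leftTrivial k H)).comp (antipodeEquiv hS).symm.toAlgHom) (antipodeEquiv hS a)
        (leftTrivialEquiv k H x) = a • leftTrivialEquiv k H x := by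
      simp [rep_apply]
    rw [this, smul_leftTrivialEquiv, LinearEquiv.trans_apply, LinearEquiv.trans_apply,
      LinearEquiv.symm_apply_apply, LinearEquiv.symm_apply_apply, smul_rightTrivialEquiv,
      antipodeEquiv_apply, unop_op, counit_antipode])

/-- The antipode turns the regular right module into the regular left module. -/
def resRightRegIso (hS : Function.Bijective (antipode k : H →ₗ[k] H)) :
    (resFunctor (antipodeEquiv hS).toAlgHom).obj (rightRegModule H) ≅ regModule H :=
  ofRepIso (φ := (rep k (rightRegModule H)).comp (antipodeEquiv hS).toAlgHom)
    ((rightRegEquiv k H).symm ≪≫ₗ (LinearEquiv.ofBijective (antipode k) hS).symm ≪≫ₗ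
      regEquiv k H) (by
    intro a x
    obtain ⟨x, rfl⟩ := (LinearEquiv.ofBijective (antipode k) hS ≪≫ₗ rightRegEquiv k H).surjective x
    have : ((rep k (rightRegModule H)).comp (antipodeEquiv hS).toAlgHom) a
        ((LinearEquiv.ofBijective (antipode k) hS ≪≫ₗ rightRegEquiv k H) x) =
        (LinearEquiv.ofBijective (antipode k) hS ≪≫ₗ rightRegEquiv k H) (a * x) := by
      change rightRegEquiv k H (antipode k x * antipode k a) = rightRegEquiv k H (antipode k (a * x))
      rw [antipode_mul_antidistrib]
    rw [this]
    simp only [LinearEquiv.trans_apply, LinearEquiv.symm_apply_apply]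
    rw [smul_regEquiv])

/-- Right and left extensions of the trivial module by the regular module agree. -/
def rightExtEquiv (hS : Function.Bijective (antipode k : H →ₗ[k] H)) (n : ℕ) :
    Ext.{u} (rightTrivial k H) (rightRegModule H) n ≃ₗ[k]
      Ext.{u} (leftTrivial k H) (regModule H) n :=
  { Ext.precompIso (resLeftTrivialIso hS) (rightRegModule H) n with
    map_smul' := fun c x => Ext.precompIso_smul (resLeftTrivialIso hS) _ n c x } ≪≫ₗ
    resExtEquiv (antipodeEquiv hS) (leftTrivial k H) (rightRegModule H) n ≪≫ₗ
    { Ext.postcompIso (leftTrivial k H) (resRightRegIso hS) n with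
      map_smul' := fun c x => Ext.postcompIso_smul _ (resRightRegIso hS) n c x }

end RightModules

/-! ### Ext from finite dimensional modules to H -/

section FiniteDimensional

open Coalgebra HopfAlgebra ModuleCat

variable {k : Type u} [Field k] {H : Type u} [Ring H] [HopfAlgebra k H]

section

variable {V : Type u} [AddCommGroup V] [Module k V] (θ : H →ₐ[k] Module.End k V)

/-- The dual representation. -/
def dualRep : H →ₐ[k] Module.End k (V →ₗ[k] k) :=
  (precompRep θ k).comp (antipodeAlgHomOp k H)

lemma dualRep_apply (h : H) (f : V →ₗ[k] k) (v : V) :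
    dualRep θ h f v = f (θ (antipode k h) v) := rfl

variable [Module.Finite k V]

/-- For finite dimensional `V`, the linear isomorphism `H ⊗ V^* ≅ Hom(V, H)`. -/
def tensorDualEquiv : H ⊗[k] (V →ₗ[k] k) ≃ₗ[k] V →ₗ[k] regModule H :=
  TensorProduct.comm k H (V →ₗ[k] k) ≪≫ₗ dualTensorHomEquiv k V H ≪≫ₗ
    (regEquiv k H).congrRight

lemma tensorDualEquiv_apply (a : H) (f : V →ₗ[k] k) (v : V) :
    tensorDualEquiv (a ⊗ₜ f) v = regEquiv k H (f v • a) := rfl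

/-- For finite dimensional `V`, the module `H ⊗ V^*` is isomorphic to `Hom(V, H)`. -/
def diagDualIso : diagModule (dualRep θ) ≅ ofRep (homRep θ (regModule H)) :=
  ofRepIso (tensorDualEquiv ≪≫ₗ ofRepEquiv _) (by
    intro h x
    rw [LinearEquiv.trans_apply, LinearEquiv.trans_apply, smul_ofRepEquiv]
    congr 1
    induction x with
    | zero => simp
    | add x y hx hy => simp only [map_add, hx, hy]
    | tmul a f =>
      let r := Repr.arbitrary k h
      ext v
      rw [homRep_apply _ _ r, tensorRep_apply _ _ r, map_sum, LinearMap.sum_apply]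
      refine Finset.sum_congr rfl fun j _ => ?_
      rw [tensorDualEquiv_apply, tensorDualEquiv_apply, smul_regEquiv, dualRep_apply, mul_smul_comm]
      rfl)

/-- For finite dimensional V, Ext(V, H) ≅ Ext(k, Hom(V, H)) and Hom(V, H) ≅ H ⊗ V^*, which untwists
to a free module. A functional f gives x ⊗ f; contracting with v ∈ V returns f(v) x, so f can be
recovered. -/
lemma exists_injective_dual_ext {n : ℕ} {x : Ext.{u} (leftTrivial k H) (regModule H) n}
    (hx : x ≠ 0) :
    ∃ Φ : (V →ₗ[k] k) →ₗ[k] Ext.{u} (ofRep θ) (regModule H) n, Function.Injective Φ := by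
  let j : (V →ₗ[k] k) →ₗ[k] (regModule H ⟶ ofRep (homRep θ (regModule H))) :=
    { toFun := fun f => diagIncl (dualRep θ) f ≫ (diagDualIso θ).hom
      map_add' := fun f g => by rw [diagIncl_add, Preadditive.add_comp]
      map_smul' := fun c f => by rw [diagIncl_smul, Linear.smul_comp]; rfl }
  refine ⟨(homExtEquiv θ (regModule H) n).symm.toLinearMap ∘ₗ extPush k _ x ∘ₗ j,
    (homExtEquiv θ (regModule H) n).symm.injective.comp ?_⟩
  refine (injective_iff_map_eq_zero (extPush k _ x ∘ₗ j)).2 fun f hf => LinearMap.ext fun v => ?_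
  have h : extPush k _ (extPush k _ x (j f))
      ((diagDualIso θ).inv ≫ diagProj (dualRep θ) (Module.Dual.eval k V v)) = f v • x := by
    have hc : j f ≫ (diagDualIso θ).inv ≫ diagProj (dualRep θ) (Module.Dual.eval k V v) =
        f v • 𝟙 _ := by
      change (diagIncl (dualRep θ) f ≫ (diagDualIso θ).hom) ≫ _ = _
      rw [Category.assoc, Iso.hom_inv_id_assoc, diagIncl_comp_diagProj]
      rfl
    rw [← extPush_comp, hc, map_smul, extPush_id]
  rw [show extPush k _ x (j f) = 0 from hf, extPush_zero] at h
  exact (smul_eq_zero.1 h.symm).resolve_right hx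

end

lemma ModuleCat.exists_injective_dual_ext (M : ModuleCat.{u} H) [Module.Finite k M] {n : ℕ}
    {x : Ext.{u} (leftTrivial k H) (regModule H) n} (hx : x ≠ 0) :
    ∃ Φ : (M →ₗ[k] k) →ₗ[k] Ext.{u} M (regModule H) n, Function.Injective Φ := by
  obtain ⟨Φ, hΦ⟩ := _root_.exists_injective_dual_ext (rep k M) hx
  let ι : M ≅ ofRep (rep k M) :=
    (ofRepIso (φ := rep k M) (LinearEquiv.refl k M) fun _ _ => rfl).symm
  let Ψ : Ext.{u} (ofRep (rep k M)) (regModule H) n ≃ₗ[k] Ext.{u} M (regModule H) n :=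
    { Ext.precompIso ι (regModule H) n with
      map_smul' := fun c y => Ext.precompIso_smul ι _ n c y }
  exact ⟨Ψ.toLinearMap ∘ₗ Φ, Ψ.injective.comp hΦ⟩

end FiniteDimensional

/-! ### The H-module Hom(Q, H) for a bimodule Q, and its reflexivity -/

section Cochains

open Coalgebra HopfAlgebra ModuleCat

variable {k : Type u} [Field k] {H : Type u} [Ring H] [HopfAlgebra k H]
  {E : Type u} [Ring E] [Algebra k E] (e : EnvelopingAlgebra k H ≃ₐ[k] E)

/-- `H` as a bimodule with trivial right action. -/
abbrev inflatedReg : ModuleCat.{u} E := ofRep ((rep k (regModule H)).comp (counitRight' e))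

/-- The underlying vector space of `inflatedReg`. -/
def inflatedRegEquiv : H ≃ₗ[k] inflatedReg e := regEquiv k H ≪≫ₗ ofRepEquiv _

lemma smul_inflatedRegEquiv (a : E) (x : H) :
    a • inflatedRegEquiv e x = inflatedRegEquiv e (counitRight' e a * x) := rfl

/-- Right multiplication on `inflatedReg`. -/
abbrev inflatedMulRight (a : H) : inflatedReg e ⟶ inflatedReg e :=
  (inflationFunctor e).map (regMulRight a)

lemma inflatedMulRight_apply (a x : H) :
    (inflatedMulRight e a).hom (inflatedRegEquiv e x) = inflatedRegEquiv e (x * a) := rfl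

lemma inflatedMulRight_add (a b : H) :
    inflatedMulRight e (a + b) = inflatedMulRight e a + inflatedMulRight e b :=
  (congrArg (inflationFunctor e).map (regMulRight_add a b)).trans (Functor.map_add _)

lemma inflatedMulRight_smul (c : k) (a : H) :
    inflatedMulRight e (c • a) = c • inflatedMulRight e a :=
  (congrArg (inflationFunctor e).map (regMulRight_smul c a)).trans (Functor.map_smul _ _ _)

lemma inflatedMulRight_one : inflatedMulRight e (1 : H) = 𝟙 (inflatedReg e) :=
  (congrArg (inflationFunctor e).map regMulRight_one).trans ((inflationFunctor e).map_id _)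

lemma inflatedMulRight_comp (a b : H) :
    inflatedMulRight e a ≫ inflatedMulRight e b = inflatedMulRight e (a * b) :=
  ((congrArg (inflationFunctor e).map (regMulRight_comp a b)).symm.trans
    (Functor.map_comp _ _ _)).symm

/-- The representation of `H` on `Hom(Q, H)` by right multiplication through the antipode. -/
def cochainRep (Q : ModuleCat.{u} E) : H →ₐ[k] Module.End k (Q ⟶ inflatedReg e) :=
  AlgHom.ofLinearMap
    { toFun := fun h => Linear.rightComp k Q (inflatedMulRight e (antipode k h))
      map_add' := fun a b => LinearMap.ext fun f => by
        rw [LinearMap.add_apply, Linear.rightComp_apply, Linear.rightComp_apply,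
          Linear.rightComp_apply, map_add, inflatedMulRight_add, Preadditive.comp_add]
      map_smul' := fun c a => LinearMap.ext fun f => by
        rw [LinearMap.smul_apply, Linear.rightComp_apply, Linear.rightComp_apply, map_smul,
          inflatedMulRight_smul, Linear.comp_smul, RingHom.id_apply] }
    (LinearMap.ext fun f => by
      change f ≫ inflatedMulRight e (antipode k 1) = f
      rw [antipode_one, inflatedMulRight_one, Category.comp_id])
    (fun a b => LinearMap.ext fun f => by
      change f ≫ inflatedMulRight e (antipode k (a * b)) =
        (f ≫ inflatedMulRight e (antipode k b)) ≫ inflatedMulRight e (antipode k a)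
      rw [antipode_mul_antidistrib, ← inflatedMulRight_comp, Category.assoc])

/-- The `H`-module `Hom(Q, H)`. -/
abbrev cochain (Q : ModuleCat.{u} E) : ModuleCat.{u} H := ofRep (cochainRep e Q)

/-- Precomposition as a morphism of `cochain` modules. -/
def cochainMap {Q Q' : ModuleCat.{u} E} (g : Q ⟶ Q') : cochain e Q' ⟶ cochain e Q :=
  ofRepDesc ((ofRepEquiv _).toLinearMap ∘ₗ Linear.leftComp k (inflatedReg e) g) (by
    intro a f
    rw [LinearMap.comp_apply, LinearMap.comp_apply, LinearEquiv.coe_coe, smul_ofRepEquiv]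
    congr 1)

lemma cochain_hom_ext {Q : ModuleCat.{u} E} {M : ModuleCat.{u} H} {a b : cochain e Q ⟶ M}
    (h : ∀ f, a.hom (ofRepEquiv _ f) = b.hom (ofRepEquiv _ f)) : a = b :=
  ModuleCat.hom_ext (LinearMap.ext h)

lemma cochainMap_apply {Q Q' : ModuleCat.{u} E} (g : Q ⟶ Q') (f : Q' ⟶ inflatedReg e) :
    (cochainMap e g).hom (ofRepEquiv _ f) = ofRepEquiv _ (g ≫ f) := rfl

lemma cochainMap_comp {Q Q' Q'' : ModuleCat.{u} E} (g : Q ⟶ Q') (g' : Q' ⟶ Q'') :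
    cochainMap e g' ≫ cochainMap e g = cochainMap e (g ≫ g') := by
  ext f
  exact congrArg (ofRepEquiv (cochainRep e Q)) (Category.assoc g g' _).symm

lemma cochainMap_add {Q Q' : ModuleCat.{u} E} (g g' : Q ⟶ Q') :
    cochainMap e (g + g') = cochainMap e g + cochainMap e g' := by
  ext f
  exact congrArg (ofRepEquiv (cochainRep e Q)) (Preadditive.add_comp _ _ _ g g' _)

lemma cochainMap_id (Q : ModuleCat.{u} E) : cochainMap e (𝟙 Q) = 𝟙 _ := by
  refine cochain_hom_ext e fun f => ?_
  rw [cochainMap_apply, Category.id_comp]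
  rfl

/-- `cochainMap` as an additive map. -/
def cochainMapHom (Q Q' : ModuleCat.{u} E) : (Q ⟶ Q') →+ (cochain e Q' ⟶ cochain e Q) :=
  AddMonoidHom.mk' (cochainMap e) (cochainMap_add e)

lemma cochainMap_zero (Q Q' : ModuleCat.{u} E) : cochainMap e (0 : Q ⟶ Q') = 0 :=
  (cochainMapHom e Q Q').map_zero

lemma cochainMap_sum {Q Q' : ModuleCat.{u} E} {ι : Type*} (s : Finset ι) (g : ι → (Q ⟶ Q')) :
    cochainMap e (∑ j ∈ s, g j) = ∑ j ∈ s, cochainMap e (g j) :=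
  map_sum (cochainMapHom e Q Q') g s

variable (hS : Function.Bijective (antipode k : H →ₗ[k] H))

lemma ofBijective_symm_antipode (x : H) :
    (LinearEquiv.ofBijective (antipode k) hS).symm (antipode k x) = x :=
  (LinearEquiv.ofBijective (antipode k) hS).symm_apply_apply x

/-- Evaluation of cochains at an element, made linear by the inverse of the antipode. -/
def cochainEval {Q : ModuleCat.{u} E} (q : Q) : cochain e Q ⟶ regModule H :=
  ofRepDesc
    { toFun := fun f => regEquiv k H ((LinearEquiv.ofBijective (antipode k) hS).symm
        ((inflatedRegEquiv e).symm (f.hom q)))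
      map_add' := fun f g => by rw [ModuleCat.hom_add, LinearMap.add_apply, map_add, map_add, map_add]
      map_smul' := fun c f => by rw [smul_hom_apply, map_smul, map_smul, map_smul]; rfl } (by
    intro h f
    change regEquiv k H ((LinearEquiv.ofBijective (antipode k) hS).symm
      ((inflatedRegEquiv e).symm ((inflatedMulRight e (antipode k h)).hom (f.hom q)))) =
      h • regEquiv k H ((LinearEquiv.ofBijective (antipode k) hS).symm
        ((inflatedRegEquiv e).symm (f.hom q)))
    obtain ⟨x, hx⟩ := (LinearEquiv.ofBijective (antipode k) hS ≪≫ₗ inflatedRegEquiv e).surjective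
      (f.hom q)
    rw [LinearEquiv.trans_apply, LinearEquiv.ofBijective_apply] at hx
    rw [← hx, inflatedMulRight_apply, LinearEquiv.symm_apply_apply, LinearEquiv.symm_apply_apply,
      ← antipode_mul_antidistrib, ofBijective_symm_antipode, ofBijective_symm_antipode,
      smul_regEquiv])

lemma cochainEval_apply {Q : ModuleCat.{u} E} (q : Q) {f : Q ⟶ inflatedReg e} {x : H}
    (h : f.hom q = inflatedRegEquiv e (antipode k x)) :
    (cochainEval e hS q).hom (ofRepEquiv _ f) = regEquiv k H x := by
  change regEquiv k H ((LinearEquiv.ofBijective (antipode k) hS).symm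
    ((inflatedRegEquiv e).symm (f.hom q))) = _
  rw [h, LinearEquiv.symm_apply_apply, ofBijective_symm_antipode]

include hS in
lemma exists_eq_antipode {Q : ModuleCat.{u} E} (q : Q) (f : Q ⟶ inflatedReg e) :
    ∃ x : H, f.hom q = inflatedRegEquiv e (antipode k x) := by
  obtain ⟨x, hx⟩ := (LinearEquiv.ofBijective (antipode k) hS ≪≫ₗ inflatedRegEquiv e).surjective
      (f.hom q)
  exact ⟨x, hx.symm⟩

lemma cochainMap_comp_cochainEval {Q Q' : ModuleCat.{u} E} (g : Q ⟶ Q') (q : Q) :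
    cochainMap e g ≫ cochainEval e hS q = cochainEval e hS (g.hom q) := rfl

lemma cochainEval_add {Q : ModuleCat.{u} E} (q q' : Q) :
    cochainEval e hS (q + q') = cochainEval e hS q + cochainEval e hS q' := by
  refine cochain_hom_ext e fun f => ?_
  obtain ⟨x, hx⟩ := exists_eq_antipode e hS q f
  obtain ⟨y, hy⟩ := exists_eq_antipode e hS q' f
  rw [ModuleCat.hom_add, LinearMap.add_apply, cochainEval_apply e hS q hx,
    cochainEval_apply e hS q' hy, ← map_add]
  refine cochainEval_apply e hS _ ?_
  rw [map_add, hx, hy, map_add, map_add]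

/-- `cochainEval` as an additive map. -/
def cochainEvalHom (Q : ModuleCat.{u} E) : Q →+ (cochain e Q ⟶ regModule H) :=
  AddMonoidHom.mk' (cochainEval e hS) (cochainEval_add e hS)

/-- The target of the cochains has trivial right action, so the right action on Q is seen only
through ε. -/
lemma cochainEval_one_tmul_smul {Q : ModuleCat.{u} E} (q : Q) (h : H) :
    cochainEval e hS (e (1 ⊗ₜ op h) • q) = counit (R := k) h • cochainEval e hS q := by
  refine cochain_hom_ext e fun f => ?_
  obtain ⟨x, hx⟩ := exists_eq_antipode e hS q f
  rw [smul_hom_apply, cochainEval_apply e hS q hx, ← map_smul]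
  refine cochainEval_apply e hS _ ?_
  rw [map_smul, hx, smul_inflatedRegEquiv, counitRight'_apply, counitRight_tmul, unop_op,
    smul_mul_assoc, one_mul, map_smul, map_smul, map_smul]

lemma cochainEval_tmul_one_smul {Q : ModuleCat.{u} E} (q : Q) (y : H) :
    cochainEval e hS (e (antipode k y ⊗ₜ 1) • q) = cochainEval e hS q ≫ regMulRight y := by
  refine cochain_hom_ext e fun f => ?_
  obtain ⟨x, hx⟩ := exists_eq_antipode e hS q f
  rw [ModuleCat.hom_comp, LinearMap.comp_apply, cochainEval_apply e hS q hx, regMulRight_apply]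
  refine cochainEval_apply e hS _ ?_
  rw [map_smul, hx, smul_inflatedRegEquiv, counitRight'_apply, counitRight_tmul, unop_one,
    Bialgebra.counit_one, one_smul, antipode_mul_antidistrib]

lemma bijective_cochainEval_one :
    Function.Bijective (cochainEval e hS (regEquiv k E 1)).hom := by
  constructor
  · refine (injective_iff_map_eq_zero _).2 fun f hf => ?_
    obtain ⟨f, rfl⟩ := (ofRepEquiv (cochainRep e (regModule E))).surjective f
    obtain ⟨x, hx⟩ := exists_eq_antipode e hS (regEquiv k E 1) f
    rw [cochainEval_apply e hS _ hx] at hf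
    rw [(regEquiv k H).injective (hf.trans (map_zero _).symm), map_zero, map_zero] at hx
    rw [show f = 0 from regModule_hom_ext k (g := 0) hx, map_zero]
  · intro x
    obtain ⟨x, rfl⟩ := (regEquiv k H).surjective x
    refine ⟨ofRepEquiv _ (ModuleCat.ofHom (X := regModule E) (Y := inflatedReg e)
      (LinearMap.toSpanSingleton E (inflatedReg e)
      (inflatedRegEquiv e (antipode k x)))), cochainEval_apply e hS _ ?_⟩
    exact one_smul E (inflatedRegEquiv e (antipode k x))

instance : IsIso (cochainEval e hS (regEquiv k E 1)) :=
  (ConcreteCategory.isIso_iff_bijective _).2 (bijective_cochainEval_one e hS)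

/-- Evaluation at 1 identifies Hom(Hᵉ, H) with H. An endomorphism of H is right multiplication by
some y, which is evaluation at S(y) ⊗ 1. -/
lemma exists_eq_cochainEval_of_regModule (g : cochain e (regModule E) ⟶ regModule H) :
    ∃ q, g = cochainEval e hS q := by
  obtain ⟨y, hy⟩ := (regEquiv k H).surjective
    ((inv (cochainEval e hS (regEquiv k E 1)) ≫ g).hom (regEquiv k H 1))
  refine ⟨e (antipode k y ⊗ₜ 1) • regEquiv k E 1, ?_⟩
  rw [cochainEval_tmul_one_smul, ← IsIso.inv_comp_eq]
  refine regModule_hom_ext k ?_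
  rw [regMulRight_apply, one_mul, hy]

lemma ModuleCat.exists_dual_basis {R : Type u} [Ring R] (Q : ModuleCat.{u} R) [Projective Q]
    [Module.Finite R Q] : ∃ (n : ℕ) (φ : Fin n → (Q ⟶ regModule R)) (ψ : Fin n → (regModule R ⟶ Q)),
      ∑ j, φ j ≫ ψ j = 𝟙 Q := by
  have : Module.Projective R Q := (IsProjective.iff_projective Q).2 inferInstance
  obtain ⟨n, f, g, -, -, hfg⟩ := Module.Finite.exists_comp_eq_id_of_projective R Q
  refine ⟨n, fun j => ModuleCat.ofHom (LinearMap.proj j ∘ₗ g),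
    fun j => ModuleCat.ofHom (f ∘ₗ LinearMap.single R (fun _ => R) j), ?_⟩
  ext x
  rw [ModuleCat.hom_sum, LinearMap.sum_apply]
  change ∑ j, f (Pi.single j (g x j)) = x
  rw [← map_sum, Finset.univ_sum_single]
  exact congr($hfg x)

lemma projective_of_sum_comp {C : Type*} [Category* C] [Preadditive C] {M P : C} [Projective P]
    {ι : Type*} (s : Finset ι) (a : ι → (M ⟶ P)) (b : ι → (P ⟶ M))
    (h : ∑ j ∈ s, a j ≫ b j = 𝟙 M) : Projective M where
  factors f g _ := ⟨∑ j ∈ s, a j ≫ Projective.factorThru (b j ≫ f) g, by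
    simp only [Preadditive.sum_comp, Category.assoc, Projective.factorThru_comp]
    simp only [← Category.assoc]
    rw [← Preadditive.sum_comp, h, Category.id_comp]⟩

include hS in
-- A dual basis of Q makes its cochain module a retract of a finite sum of copies of Hom(Hᵉ, H) ≅ H.
lemma projective_cochain (Q : ModuleCat.{u} E) [Projective Q] [Module.Finite E Q] :
    Projective (cochain e Q) := by
  obtain ⟨n, φ, ψ, h⟩ := Q.exists_dual_basis
  have : Projective (regModule H) := projective_of_free (Module.Basis.singleton PUnit.{1} H)
  have : Projective (cochain e (regModule E)) :=
    Projective.of_iso (asIso (cochainEval e hS (regEquiv k E 1))).symm this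
  refine projective_of_sum_comp Finset.univ (fun j => cochainMap e (ψ j))
    (fun j => cochainMap e (φ j)) ?_
  simp_rw [cochainMap_comp, ← cochainMap_sum]
  rw [h, cochainMap_id]

/-- The case of Hᵉ spreads to finitely generated projectives by a dual basis. -/
lemma exists_eq_cochainEval (Q : ModuleCat.{u} E) [Projective Q] [Module.Finite E Q]
    (g : cochain e Q ⟶ regModule H) : ∃ q, g = cochainEval e hS q := by
  obtain ⟨n, φ, ψ, h⟩ := Q.exists_dual_basis
  choose q hq using fun j => exists_eq_cochainEval_of_regModule e hS (cochainMap e (φ j) ≫ g)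
  refine ⟨∑ j, (ψ j).hom (q j), ?_⟩
  refine Eq.trans ?_ (map_sum (cochainEvalHom e hS Q) _ _).symm
  change _ = ∑ j, cochainEval e hS ((ψ j).hom (q j))
  simp_rw [← cochainMap_comp_cochainEval, ← hq, ← Category.assoc, cochainMap_comp]
  rw [← Preadditive.sum_comp, ← cochainMap_sum, h, cochainMap_id, Category.id_comp]

end Cochains

/-! ### From finite dimensional Ext to a single line -/

section FiniteExt

open Coalgebra HopfAlgebra ModuleCat

variable {k : Type u} [Field k] {H : Type u} [Ring H] [HopfAlgebra k H]
  {E : Type u} [Ring E] [Algebra k E] (e : EnvelopingAlgebra k H ≃ₐ[k] E)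
  {D : ModuleCat.{u} E} (P : ProjectiveResolution D)

/-- The differential of the complex `Hom(P, H)`. -/
def cochainDiff (j : ℕ) : cochain e (P.complex.X j) ⟶ cochain e (P.complex.X (j + 1)) :=
  cochainMap e (P.complex.d (j + 1) j)

lemma cochainDiff_comp (j : ℕ) : cochainDiff e P j ≫ cochainDiff e P (j + 1) = 0 := by
  rw [cochainDiff, cochainDiff, cochainMap_comp, P.complex.d_comp_d, cochainMap_zero]

lemma cochainDiff_eq_zero_iff {j : ℕ} (f : P.complex.X j ⟶ inflatedReg e) :
    (cochainDiff e P j).hom (ofRepEquiv _ f) = 0 ↔ P.complex.d (j + 1) j ≫ f = 0 := by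
  rw [cochainDiff, cochainMap_apply, map_eq_zero_iff _ (LinearEquiv.injective _)]

lemma extMk_eq_zero_iff_isCoboundary {j : ℕ} (f : P.complex.X j ⟶ inflatedReg e)
    (hf : P.complex.d (j + 1) j ≫ f = 0) :
    P.extMk f (j + 1) rfl hf = 0 ↔ IsCoboundary (cochainDiff e P) j (ofRepEquiv _ f) := by
  cases j with
  | zero =>
    rw [P.extMk_zero_eq_zero_iff]
    exact (map_eq_zero_iff _ (ofRepEquiv (cochainRep e _)).injective).symm
  | succ j =>
    rw [P.extMk_eq_zero_iff _ _ _ _ j rfl]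
    constructor
    · rintro ⟨g, rfl⟩
      exact ⟨ofRepEquiv _ g, rfl⟩
    · rintro ⟨g, hg⟩
      exact ⟨(ofRepEquiv (cochainRep e _)).symm g, (ofRepEquiv (cochainRep e _)).injective hg⟩

/-- The class of a cocycle of `Hom(P, H)`. -/
def cocycleClass (s : ℕ) :
    LinearMap.ker (cochainDiff e P s).hom →ₗ[k] Ext.{u} D (inflatedReg e) s where
  toFun x := P.extMk ((ofRepEquiv (cochainRep e _)).symm x.1) (s + 1) rfl
    ((cochainDiff_eq_zero_iff e P _).1 x.2)
  map_add' x y := by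
    rw [P.add_extMk]
    rfl
  map_smul' c x := by
    rw [RingHom.id_apply, ← P.extMk_smul]
    congr 1
    exact (ofRepEquiv (cochainRep e _)).symm.map_smul c x.1

lemma cocycleClass_surjective (s : ℕ) : Function.Surjective (cocycleClass e P s) := fun y => by
  obtain ⟨f, hf, rfl⟩ := P.extMk_surjective y (s + 1) rfl
  exact ⟨⟨ofRepEquiv (cochainRep e _) f, (cochainDiff_eq_zero_iff e P f).2 hf⟩, rfl⟩

lemma cocycleClass_eq_zero_iff {s : ℕ} (x : LinearMap.ker (cochainDiff e P s).hom) :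
    cocycleClass e P s x = 0 ↔ IsCoboundary (cochainDiff e P) s x.1 :=
  extMk_eq_zero_iff_isCoboundary e P _ ((cochainDiff_eq_zero_iff e P _).1 x.2)

lemma exists_linearEquiv_of_ker_eq {K V W : Type*} [AddCommGroup K] [Module k K]
    [AddCommGroup V] [Module k V] [AddCommGroup W] [Module k W] (f : K →ₗ[k] V) (g : K →ₗ[k] W)
    (hf : Function.Surjective f) (hg : Function.Surjective g) (h : ∀ x, f x = 0 ↔ g x = 0) :
    Nonempty (V ≃ₗ[k] W) :=
  ⟨(f.quotKerEquivOfSurjective hf).symm ≪≫ₗ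
    Submodule.quotEquivOfEq _ _ (Submodule.ext fun x => by
      rw [LinearMap.mem_ker, LinearMap.mem_ker, h]) ≪≫ₗ g.quotKerEquivOfSurjective hg⟩

variable (hS : Function.Bijective (antipode k : H →ₗ[k] H))
  (i : H ≃ₗ[k] D) (hD : ∀ a b x : H, i (a * x * b) = e (a ⊗ₜ op b) • i x)

include hS i hD in
/-- If every class in `Extⁿ(V, H)` is pushed forward from a class in `Extⁿ(V, Hom(P₀, H))` that dies
in `Extⁿ(V, Hom(P₁, H))`, then `Extⁿ(V, H)` is at most one dimensional. -/
lemma exists_span_ext (hP : ∀ j, Module.Finite E (P.complex.X j)) {V : ModuleCat.{u} H} {n : ℕ}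
    (β : Ext.{u} V (cochain e (P.complex.X 0)) n)
    (hβ : β.comp (Ext.mk₀ (cochainDiff e P 0)) (add_zero n) = 0)
    (hβ' : ∀ (Y : ModuleCat.{u} H) (y : Ext.{u} V Y n),
      ∃ f : cochain e (P.complex.X 0) ⟶ Y, y = β.comp (Ext.mk₀ f) (add_zero n)) :
    ∃ w : Ext.{u} V (regModule H) n, ∀ y, ∃ c : k, c • w = y := by
  let L : P.complex.X 0 →+ Ext.{u} V (regModule H) n :=
    (extPush k (regModule H) β).toAddMonoidHom.comp (cochainEvalHom e hS (P.complex.X 0))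
  have hL (q) : L q = extPush k (regModule H) β (cochainEval e hS q) := rfl
  have hLsurj (y : Ext.{u} V (regModule H) n) : ∃ q, L q = y := by
    obtain ⟨f, rfl⟩ := hβ' _ y
    have := hP 0
    obtain ⟨q, rfl⟩ := exists_eq_cochainEval e hS (P.complex.X 0) f
    exact ⟨q, rfl⟩
  have hLd (q : P.complex.X 1) : L ((P.complex.d 1 0).hom q) = 0 := by
    rw [hL, ← cochainMap_comp_cochainEval, extPush_comp]
    rw [show extPush k _ β (cochainMap e (P.complex.d 1 0)) = 0 from hβ, extPush_zero]
  have hLa (q) (h : H) : L (e (1 ⊗ₜ op h) • q) = counit (R := k) h • L q := by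
    rw [hL, hL, cochainEval_one_tmul_smul, map_smul]
  let π : P.complex.X 0 ⟶ D := P.π.f 0
  have hπ : Function.Surjective π.hom := (ModuleCat.epi_iff_surjective _).1
    (inferInstanceAs (Epi (P.π.f 0)))
  -- By exactness of P at P₀, the map `L` factors through P₀ / im P₁ ≅ H.
  have hker (q) (hq : π.hom q = 0) : L q = 0 := by
    obtain ⟨q', rfl⟩ := ((ShortComplex.ShortExact.moduleCat_exact_iff_function_exact _).1
      P.exact₀ q).1 hq
    exact hLd q'
  obtain ⟨q₁, hq₁⟩ := hπ (i 1)
  refine ⟨L q₁, fun y => ?_⟩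
  obtain ⟨q, rfl⟩ := hLsurj y
  obtain ⟨h, hh⟩ := i.surjective (π.hom q)
  -- If q maps to h ∈ H, then q and q₁ · h have the same image in `D`, so L(q) = ε(h) L(q₁).
  refine ⟨counit h, ?_⟩
  rw [← hLa, ← sub_eq_zero, ← map_sub]
  refine hker _ ?_
  rw [map_sub, map_smul, hq₁, ← hD, one_mul, one_mul, hh, sub_self]

include hS i hD in
-- The lowest nonzero Ext, V, is squeezed: Extᵈ(V, H) contains V^*, which forces V into degree d by
-- `exists_cohomology_ext`, while `exists_span_ext` makes Extᵈ(V, H) at most one dimensional.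
lemma ext_leftTrivial_of_finite (hP : ∀ j, Module.Finite E (P.complex.X j)) {d : ℕ}
    (hpd : ∀ M : ModuleCat.{u} H, HasProjectiveDimensionLT M (d + 1))
    (hfin : ∀ j, Module.Finite k (Ext.{u} (leftTrivial k H) (regModule H) j))
    (hd : Module.finrank k (Ext.{u} (leftTrivial k H) (regModule H) d) ≠ 0) :
    (∀ j, j ≠ d → Subsingleton (Ext.{u} (leftTrivial k H) (regModule H) j)) ∧
      Module.finrank k (Ext.{u} (leftTrivial k H) (regModule H) d) = 1 := by
  classical
  have hex : ∃ s, Module.finrank k (Ext.{u} (leftTrivial k H) (regModule H) s) ≠ 0 := ⟨d, hd⟩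
  let s := Nat.find hex
  have hs : Module.finrank k (Ext.{u} (leftTrivial k H) (regModule H) s) ≠ 0 := Nat.find_spec hex
  have hlt (j : ℕ) (hj : j < s) : Subsingleton (Ext.{u} (leftTrivial k H) (regModule H) j) :=
    Module.finrank_zero_iff.1 (not_not.1 (Nat.find_min hex hj))
  have hsd : s ≤ d := Nat.find_min' hex hd
  have hproj (j : ℕ) : Projective (cochain e (P.complex.X j)) := by
    have := hP j
    exact projective_cochain e hS _
  obtain ⟨V, c, hc, hck, hV⟩ := exists_cohomology_ext (cochainDiff e P) s d (cochainDiff_comp e P)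
    (fun j hj x hx => by
      obtain ⟨f, rfl⟩ := (ofRepEquiv (cochainRep e (P.complex.X j))).surjective x
      rw [cochainDiff_eq_zero_iff] at hx
      rw [← extMk_eq_zero_iff_isCoboundary e P f hx]
      have := hlt j hj
      exact (inflationExtEquiv e i hD (regModule H) j).injective (Subsingleton.elim _ _))
    hpd hsd
  let c' : LinearMap.ker (cochainDiff e P s).hom →ₗ[k] V := c.restrictScalars k
  obtain ⟨ε⟩ := exists_linearEquiv_of_ker_eq c' (cocycleClass e P s) hc
    (cocycleClass_surjective e P s) fun x => (hck x).trans (cocycleClass_eq_zero_iff e P x).symm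
  let ε' : V ≃ₗ[k] Ext.{u} (leftTrivial k H) (regModule H) s :=
    ε ≪≫ₗ inflationExtEquiv e i hD (regModule H) s
  have : Module.Finite k V := Module.Finite.equiv ε'.symm
  have hrk := ε'.finrank_eq
  obtain ⟨x, hx⟩ : ∃ x : Ext.{u} (leftTrivial k H) (regModule H) d, x ≠ 0 := by
    by_contra! h
    have := subsingleton_of_forall_eq _ h
    exact hd Module.finrank_zero_of_subsingleton
  obtain ⟨Φ, hΦ⟩ := V.exists_injective_dual_ext hx
  have hdual : Module.finrank k (V →ₗ[k] k) = Module.finrank k V := Subspace.dual_finrank_eq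
  obtain ⟨f, hf⟩ : ∃ f : V →ₗ[k] k, f ≠ 0 := by
    by_contra! h
    have := subsingleton_of_forall_eq _ h
    exact hs (hrk ▸ hdual ▸ Module.finrank_zero_of_subsingleton)
  -- A nonzero functional on `V` supplies the nonzero class in Extᵈ(V, H).
  obtain ⟨hsd', β, hβ, hβ'⟩ := hV ⟨_, Φ f, fun h => hf (hΦ (h.trans (map_zero Φ).symm))⟩
  obtain ⟨w, hw⟩ := exists_span_ext e P hS i hD hP β hβ hβ'
  have : Module.Finite k (Ext.{u} V (regModule H) d) :=
    Module.Finite.of_surjective (LinearMap.toSpanSingleton k _ w) hw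
  -- dim V = dim V^* ≤ dim Extᵈ(V, H) ≤ 1.
  have hle := (LinearMap.finrank_le_finrank_of_injective hΦ).trans (finrank_le_one w hw)
  rw [hdual, hrk] at hle
  refine ⟨fun j hj => ?_, ?_⟩
  · rcases lt_or_gt_of_ne hj with hj | hj
    · exact hlt j (hsd' ▸ hj)
    · have := hpd (leftTrivial k H)
      exact subsingleton_of_forall_eq 0 fun y =>
        y.eq_zero_of_hasProjectiveDimensionLT (d + 1) hj
  · rw [← hsd']
    omega

end FiniteExt

/-! ### The equivalences and the dimensions -/

section Main

open Coalgebra HopfAlgebra ModuleCat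

variable {k : Type u} [Field k] {H : Type u} [Ring H] [HopfAlgebra k H]

lemma subsingleton_of_finrank_eq_zero {V : Type*} [AddCommGroup V] [Module k V] [Module.Finite k V]
    (h : Module.finrank k V = 0) : Subsingleton V :=
  Module.finrank_zero_iff.1 h

section

variable {E : Type u} [Ring E] [Algebra k E] (e : EnvelopingAlgebra k H ≃ₐ[k] E)
  {D : ModuleCat.{u} E} (i : H ≃ₗ[k] D) (hD : ∀ a b x : H, i (a * x * b) = e (a ⊗ₜ op b) • i x)
  (P : ProjectiveResolution D) (hP : ∀ j, Module.Finite E (P.complex.X j))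
include i hD hP

lemma hasLocallyFiniteExt_leftTrivial_of_resolution : (leftTrivial k H).HasLocallyFiniteExt :=
  hasLocallyFiniteExt_leftTrivial e i hD fun _ _ q hq _ x => ext_eq_sum_comp_of_finite P hP q hq x

variable {m : ℕ} (hm : ∀ j, m < j → Limits.IsZero (P.complex.X j))
include hm

/-- The bounded resolution gives k finite projective dimension, vanishing of Ext(k, H) above d
lowers it to d, and k bounds all other modules. -/
lemma hasProjectiveDimensionLT_of_ext_leftTrivial {d : ℕ}
    (h : ∀ j, d < j → Subsingleton (Ext.{u} (leftTrivial k H) (regModule H) j))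
    (M : ModuleCat.{u} H) : HasProjectiveDimensionLT M (d + 1) := by
  have := hasProjectiveDimensionLT_of_resolution P hm
  have := hasProjectiveDimensionLT_leftTrivial e i hD (m := m + 1)
  have := (hasLocallyFiniteExt_leftTrivial_of_resolution e i hD P hP).hasProjectiveDimensionLT
    (m := m + 1) (d := d) fun j hj x => by
      have := h j hj
      exact Subsingleton.elim (α := Ext.{u} (leftTrivial k H) (regModule H) j) x 0
  exact hasProjectiveDimensionLT_of_leftTrivial (k := k) M

lemma dimension_eq_of_ext_leftTrivial (hS : Function.Bijective (antipode k : H →ₗ[k] H)) {d : ℕ}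
    (h : ∀ j, j ≠ d → Subsingleton (Ext.{u} (leftTrivial k H) (regModule H) j))
    (hd : Module.finrank k (Ext.{u} (leftTrivial k H) (regModule H) d) = 1) :
    globalDimension H = d ∧ globalDimension Hᵐᵒᵖ = d ∧ injectiveDimension (regModule H) = d ∧
      injectiveDimension (rightRegModule H) = d := by
  have hpd := hasProjectiveDimensionLT_of_ext_leftTrivial e i hD P hP hm
    fun j hj => h j (ne_of_gt hj)
  have hpd' := hasProjectiveDimensionLT_of_algEquiv (antipodeEquiv hS) hpd
  obtain ⟨x, hx, -⟩ := finrank_eq_one_iff'.1 hd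
  have hx' : (rightExtEquiv hS d).symm x ≠ 0 := (rightExtEquiv hS d).symm.map_ne_zero_iff.2 hx
  exact ⟨globalDimension_eq hpd hx, globalDimension_eq hpd' hx', injectiveDimension_eq hpd hx,
    injectiveDimension_eq hpd' hx'⟩

lemma tfae_twistedCalabiYau (hS : Function.Bijective (antipode k : H →ₗ[k] H)) (d : ℕ) :
    List.TFAE [
      (∀ j, j ≠ d → Subsingleton (Ext.{u} D (regModule E) j)) ∧
        ∃ (μ : H ≃ₐ[k] H) (φ : Ext.{u} D (regModule E) d ≃+ H),
          ∀ (a b : H) (x : Ext.{u} D (regModule E) d),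
            φ (extPush k _ x (regMulRight (e (a ⊗ₜ op b)))) = b * φ x * μ a,
      (∀ j, j ≠ d → Subsingleton (Ext.{u} (leftTrivial k H) (regModule H) j)) ∧
        Module.finrank k (Ext.{u} (leftTrivial k H) (regModule H) d) = 1,
      (∀ j, j ≠ d → Subsingleton (Ext.{u} (rightTrivial k H) (rightRegModule H) j)) ∧
        Module.finrank k (Ext.{u} (rightTrivial k H) (rightRegModule H) d) = 1,
      (∀ j, Module.Finite k (Ext.{u} (leftTrivial k H) (regModule H) j) ∧
          Module.Finite k (Ext.{u} (rightTrivial k H) (rightRegModule H) j)) ∧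
        (∀ j, d < j →
          Module.finrank k (Ext.{u} (leftTrivial k H) (regModule H) j) = 0 ∧
            Module.finrank k (Ext.{u} (rightTrivial k H) (rightRegModule H) j) = 0) ∧
        (Module.finrank k (Ext.{u} (leftTrivial k H) (regModule H) d) ≠ 0 ∨
          Module.finrank k (Ext.{u} (rightTrivial k H) (rightRegModule H) d) ≠ 0)] := by
  have hX := hasLocallyFiniteExt_leftTrivial_of_resolution e i hD P hP
  have hrank (j : ℕ) := (rightExtEquiv hS j).finrank_eq
  tfae_have 1 → 2 := by
    rintro ⟨h0, μ, φ, hφ⟩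
    exact ext_leftTrivial_of_ext_regModule e i hD hX h0 (map_one μ) φ hφ
  tfae_have 2 → 1 := fun ⟨h0, h1⟩ => ext_regModule_of_ext_leftTrivial e i hD hS hX h0 h1
  tfae_have 2 → 3 := fun ⟨h0, h1⟩ => ⟨fun j hj => by
    have := h0 j hj
    exact (rightExtEquiv hS j).injective.subsingleton, (hrank d).trans h1⟩
  tfae_have 3 → 2 := fun ⟨h0, h1⟩ => ⟨fun j hj => by
    have := h0 j hj
    exact (rightExtEquiv hS j).symm.injective.subsingleton, (hrank d).symm.trans h1⟩
  tfae_have 2 → 4 := by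
    rintro ⟨h0, h1⟩
    have h0' (j : ℕ) (hj : j ≠ d) :
        Module.finrank k (Ext.{u} (leftTrivial k H) (regModule H) j) = 0 := by
      have := h0 j hj
      exact Module.finrank_zero_of_subsingleton
    have hfin (j : ℕ) : Module.Finite k (Ext.{u} (leftTrivial k H) (regModule H) j) := by
      by_cases hj : j = d
      · subst hj
        exact Module.finite_of_finrank_eq_succ h1
      · have := h0 j hj
        infer_instance
    refine ⟨fun j => ⟨hfin j, ?_⟩, fun j hj => ⟨h0' j (ne_of_gt hj), ?_⟩, Or.inl ?_⟩
    · have := hfin j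
      exact Module.Finite.equiv (rightExtEquiv hS j).symm
    · rw [hrank, h0' j (ne_of_gt hj)]
    · rw [h1]
      exact one_ne_zero
  tfae_have 4 → 2 := by
    rintro ⟨hfin, h0, hd⟩
    -- Left and right Ext have equal dimension, so either alternative in (iv) is the left one.
    rw [hrank, or_self] at hd
    refine ext_leftTrivial_of_finite e P hS i hD hP ?_ (fun j => (hfin j).1) hd
    refine hasProjectiveDimensionLT_of_ext_leftTrivial e i hD P hP hm fun j hj => ?_
    have := (hfin j).1
    exact subsingleton_of_finrank_eq_zero (h0 j hj).1
  tfae_finish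

end

variable (k H) in
/-- The underlying vector space of the bimodule `H`. -/
def envelopingDiagonalEquiv : H ≃ₗ[k] envelopingDiagonal k H where
  toFun x := x
  invFun x := x
  map_add' _ _ := rfl
  map_smul' c x := by
    refine Eq.trans ?_ (envelopingDiagonal_smul k (algebraMap k H c) 1 x).symm
    rw [mul_one]
    exact Algebra.smul_def c x
  left_inv _ := rfl
  right_inv _ := rfl

lemma envelopingDiagonalEquiv_mul (a b x : H) :
    envelopingDiagonalEquiv k H (a * x * b) =
      (AlgEquiv.refl : EnvelopingAlgebra k H ≃ₐ[k] EnvelopingAlgebra k H) (a ⊗ₜ op b) •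
        envelopingDiagonalEquiv k H x :=
  (envelopingDiagonal_smul k a b x).symm

end Main

end

theorem proposition2p7 {k : Type u} [Field k] {H : Type u} [Ring H] [HopfAlgebra k H]
    (hS : Function.Bijective (HopfAlgebra.antipode k : H →ₗ[k] H))
    (hH : IsHomologicallySmooth k H) (d : ℕ) :
    List.TFAE [
      IsTwistedCalabiYau k H d,
      (∀ i, i ≠ d → Subsingleton (LeftExt k H i)) ∧ Module.finrank k (LeftExt k H d) = 1,
      (∀ i, i ≠ d → Subsingleton (RightExt k H i)) ∧ Module.finrank k (RightExt k H d) = 1,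
      (∀ i, Module.Finite k (LeftExt k H i) ∧ Module.Finite k (RightExt k H i)) ∧
        (∀ i, d < i →
          Module.finrank k (LeftExt k H i) = 0 ∧ Module.finrank k (RightExt k H i) = 0) ∧
        (Module.finrank k (LeftExt k H d) ≠ 0 ∨ Module.finrank k (RightExt k H d) ≠ 0)] ∧
    (IsTwistedCalabiYau k H d →
      globalDimension H = d ∧ globalDimension Hᵐᵒᵖ = d ∧
      injectiveDimension (ModuleCat.of H H) = d ∧
      injectiveDimension (ModuleCat.of Hᵐᵒᵖ H) = d) := by
  obtain ⟨P, hP, m, hm⟩ := hH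
  have key := tfae_twistedCalabiYau AlgEquiv.refl (envelopingDiagonalEquiv k H)
    envelopingDiagonalEquiv_mul P hP hm hS d
  -- Smoothness is given from the start, so (i) reduces to its conditions on Ext.
  have hiff : IsTwistedCalabiYau k H d ↔
      (∀ j, j ≠ d → Subsingleton (EnvelopingExt k H j)) ∧
        ∃ (μ : H ≃ₐ[k] H) (φ : EnvelopingExt k H d ≃+ H),
          ∀ (a b : H) (x : EnvelopingExt k H d), φ (x.rightAction k H (a ⊗ₜ op b)) = b * φ x * μ a :=
    ⟨fun h => ⟨h.ext_eq_zero, h.ext_iso.imp fun _ h => h.imp fun _ h a b x => h a b x⟩,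
      fun ⟨h0, μ, φ, h⟩ => ⟨⟨P, hP, m, hm⟩, h0, μ, φ, fun a b x => h a b x⟩⟩
  have hdim := dimension_eq_of_ext_leftTrivial AlgEquiv.refl (envelopingDiagonalEquiv k H)
    envelopingDiagonalEquiv_mul P hP hm hS (d := d)
  rw [hiff]
  refine ⟨key, fun h => ?_⟩
  obtain ⟨h0, h1⟩ := (key.out 0 1).1 h
  exact hdim h0 h1
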